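/- Let $C(X)$ denote the algebra of continuous complex-valued functions on a compact Hausdorff space $X$, with the supremum norm. The space $X$ has the *Complex Stone–Weierstrass Property* (CSWP) iff every (not necessarily closed or self-adjoint) complex subalgebra of $C(X)$ that contains the constant functions and separates the points of $X$ is dense in $C(X)$. Theorem. Let $X$ be a totally ordered set that is compact in its order topology. Then $X$ has the CSWP if and only if $X$ contains no copy of the Cantor set, i.e. no subspace of $X$ is homeomorphic to the Cantor set. In particular, let $\mathbb{D} = [0,1]\times\{0\}\,\cup\,(0,1)\times\{1\}$, ordered lexicographically and given its order topology (the double arrow space). Then $\mathbb{D}$ is compact, is not scattered (it has a non-empty closed subset without isolated points), contains no copy of the Cantor set, and has the CSWP. -/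

import Mathlib

open Set Topology

/-- The Complex Stone–Weierstrass Property of a compact space `X`: every complex subalgebra of
`C(X, ℂ)` that contains the constants and separates the points of `X` is dense in `C(X, ℂ)`.
A `Subalgebra ℂ _` contains the constants by definition; it need be neither closed nor
self-adjoint. For compact `X` the topology of `C(X, ℂ)` is that of the supremum norm. -/
def HasCSWP (X : Type*) [TopologicalSpace X] : Prop :=
  ∀ A : Subalgebra ℂ C(X, ℂ), A.SeparatesPoints → Dense (A : Set C(X, ℂ))

/-- `X` contains a copy of the Cantor set: the ternary Cantor set is homeomorphic to a
subspace of `X`. -/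
def ContainsCantorSet (X : Type*) [TopologicalSpace X] : Prop :=
  ∃ f : cantorSet → X, IsEmbedding f

/-- `X` is scattered: it has no non-empty closed subset without isolated points.
(Mathlib's `Perfect` allows the empty set.) -/
def IsScatteredSpace (X : Type*) [TopologicalSpace X] : Prop :=
  ¬ ∃ Y : Set X, Y.Nonempty ∧ Perfect Y

/-- `[0,1] × {0} ∪ E × {1}`, as a subset of `ℝ × {0,1}` with the lexicographic order. -/
def doubledIntervalSet (E : Set ℝ) : Set (ℝ ×ₗ Fin 2) :=
  {p | ((ofLex p).1 ∈ Icc (0 : ℝ) 1 ∧ (ofLex p).2 = 0) ∨ ((ofLex p).1 ∈ E ∧ (ofLex p).2 = 1)}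

/-- The unit interval with the points of `E ⊆ (0,1)` doubled. -/
def DoubledInterval (E : Set ℝ) : Type := doubledIntervalSet E

/-- The lexicographic order. -/
noncomputable instance (E : Set ℝ) : LinearOrder (DoubledInterval E) :=
  inferInstanceAs (LinearOrder (doubledIntervalSet E))

/-- The order topology of the lexicographic order. -/
noncomputable instance (E : Set ℝ) : TopologicalSpace (DoubledInterval E) :=
  Preorder.topology (DoubledInterval E)

instance (E : Set ℝ) : OrderTopology (DoubledInterval E) := ⟨rfl⟩

/-- Aleksandrov's double arrow space: every point of `(0,1)` is doubled, the endpoints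
`0` and `1` are not. -/
abbrev DoubleArrow : Type := DoubledInterval (Ioo 0 1)

/-!
Let `X` be a compact ordered space.

If `X` contains a Cantor set, then it contains a copy of every compact plane set `E` whose points
have irrational coordinates, and some such `E` has positive area. The property passes to closed
subspaces (`HasCSWP.of_isEmbedding`), so a non-dense algebra on `E` is enough. Take the functions on `E` that
extend to the Riemann sphere continuously, and holomorphically off `E`. The Cauchy transform
`f z = ∫ w in E, (w - z)⁻¹` and its difference quotients separate the points of `E`. If `a` in the
algebra approximates `z` on `E`, then `(a - z) * f` is small on `E`, whereas its value at infinity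
is the area of `E`; this contradicts the maximum principle (`not_hasCSWP_of_area_pos`).

Conversely, let `A` be a separating algebra on `X` that is not dense, and let `f` be at distance at
least `d > 0` from `A`. By Zorn's lemma there is a minimal closed set `H` on which `f` remains at
distance at least `d` (`exists_isCritical`); let `B` be the closure of the restriction of `A` to
`H`. Minimality has two consequences.

* The algebra `B` has no idempotents but `0` and `1`, because an idempotent would glue
  approximations of `f` on two smaller sets. If the real part of some `g` in `B` skipped a
  value between two of its values, the sign of the shifted real part would yield an idempotent in `B`
  (`exists_mem_eq_sign_re`). So the real part of every element of `B` has a connected range.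
* A functional of norm at most one that vanishes on `B` and attains the distance at `f` has full
  support (`IsCritical.exists_hasFullSupport`). Its variation on initial segments is a monotone function
  that identifies only neighbours, so that countably many continuous functions separate all pairs of
  points of `H` that are not neighbours (`HasFullSupport.exists_countable_family`).

If only countably many pairs of neighbours remain unseparated, then `H` is metrizable, and countable
as it contains no Cantor set, so that all elements of `B` are constant. If uncountably many pairs
`(p, p')` remain, choose for each of them some `F p` in `B` with the values `0` at `p` and `1` at
`p'`. Two of these functions have graphs so close to each other that the real part of their
difference skips a value (`exists_re_sub_ne_of_uncountable`): the difference is close to `0` or, up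
to sign, to one of the countably many jumps of `F p`, but it does take a value close to `0` and one
close to `1` or `-1`. This is excluded by connected ranges, so the first case holds. As `B`
separates points, `H` then has at most one point, and a constant approximates `f` on `H`.

The double arrow space contains no Cantor set, since each of its uncountably many jumps cuts it into
two clopen sets, and the Cantor set has only countably many clopen subsets.
-/

/-! ### Idempotents in closed function algebras -/

/-- A closed function algebra contains the inverse of each of its elements that maps into
`{z | z.re ≠ 0}`: otherwise the highest purely imaginary point of the spectrum would be a boundary
point of the spectrum, hence a value of the function. -/
theorem exists_mem_eq_inv_of_re_ne_zero {X : Type*} [TopologicalSpace X] [CompactSpace X]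
    {B : Subalgebra ℂ C(X, ℂ)} (hB : IsClosed (B : Set C(X, ℂ))) {g : C(X, ℂ)} (hg : g ∈ B)
    (hre : ∀ x, (g x).re ≠ 0) : ∃ k ∈ B, ∀ x, k x = (g x)⁻¹ := by
  have : IsClosed (B : Set C(X, ℂ)) := hB
  have : CompleteSpace B := hB.completeSpace_coe
  set b : B := ⟨g, hg⟩
  have hunit : IsUnit b := by
    rw [← spectrum.zero_notMem_iff ℂ]
    intro h0
    have hcl : IsClosed (spectrum ℂ b) := spectrum.isClosed b
    have hbd : Bornology.IsBounded (spectrum ℂ b) := spectrum.isBounded b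
    let T : Set ℝ := {t | (t : ℂ) * Complex.I ∈ spectrum ℂ b}
    have hTc : IsCompact T := by
      refine Metric.isCompact_of_isClosed_isBounded (hcl.preimage (by fun_prop)) ?_
      obtain ⟨R, hR⟩ := hbd.exists_norm_le
      refine isBounded_iff_forall_norm_le.2 ⟨R, fun t ht => ?_⟩
      simpa using hR _ ht
    obtain ⟨t, ht, hmax⟩ := hTc.exists_isGreatest ⟨0, by simpa [T] using h0⟩
    have hfr : (t : ℂ) * Complex.I ∈ frontier (spectrum ℂ b) := by
      refine ⟨subset_closure ht, fun hint => ?_⟩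
      have hc : Filter.Tendsto (fun s : ℝ => (s : ℂ) * Complex.I) (𝓝[>] t)
          (𝓝 ((t : ℂ) * Complex.I)) := by
        have : Continuous (fun s : ℝ => (s : ℂ) * Complex.I) := by fun_prop
        exact (this.tendsto t).mono_left nhdsWithin_le_nhds
      have h1 := hc.eventually (mem_interior_iff_mem_nhds.1 hint)
      obtain ⟨s, hs, hs'⟩ := (h1.and self_mem_nhdsWithin).exists
      exact absurd (hmax hs) (not_le.2 hs')
    have hmem := Subalgebra.frontier_spectrum B b hfr
    rw [ContinuousMap.spectrum_eq_range] at hmem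
    obtain ⟨x, hx⟩ := hmem
    apply hre x
    change g x = _ at hx
    simp [hx]
  obtain ⟨u, hu⟩ := hunit
  refine ⟨((u⁻¹ : Bˣ) : B), ((u⁻¹ : Bˣ) : B).2, fun x => ?_⟩
  have h1 : (((u⁻¹ : Bˣ) : B) * (u : B) : B) = 1 := by simp
  have h2 := congrArg (fun c : B => (c : C(X, ℂ)) x) h1
  simp only [hu] at h2
  exact eq_inv_of_mul_eq_one_left h2

theorem re_one_add_div_one_sub_pos {w : ℂ} (hw : ‖w‖ < 1) : 0 < ((1 + w) / (1 - w)).re := by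
  have h1 : (1 - w) ≠ 0 := by
    intro h
    rw [sub_eq_zero] at h
    simp [← h] at hw
  have h2 : Complex.normSq w < 1 := by
    rw [Complex.normSq_eq_norm_sq]
    nlinarith [norm_nonneg w]
  rw [Complex.div_re, ← add_div]
  refine div_pos ?_ (Complex.normSq_pos.2 h1)
  rw [Complex.normSq_apply] at h2
  simp
  nlinarith

theorem norm_sub_one_div_add_one_lt_one {z : ℂ} (hz : 0 < z.re) : ‖(z - 1) / (z + 1)‖ < 1 := by
  have h1 : z + 1 ≠ 0 := fun h => by
    have := congrArg Complex.re h
    simp at this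
    linarith
  rw [norm_div, div_lt_one (norm_pos_iff.2 h1), ← sq_lt_sq₀ (norm_nonneg _) (norm_nonneg _),
    ← Complex.normSq_eq_norm_sq, ← Complex.normSq_eq_norm_sq, Complex.normSq_apply,
    Complex.normSq_apply]
  simp
  nlinarith

/-- If an element `g` of a closed function algebra misses the imaginary axis, then the algebra
contains the sign of `g.re`. It is the limit of the iterates of `z ↦ (z + z⁻¹) / 2` at `g`: in the
coordinate `w = (z - 1) / (z + 1)`, this map is `w ↦ w ^ 2`. -/
theorem exists_mem_eq_sign_re {X : Type*} [TopologicalSpace X] [CompactSpace X]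
    {B : Subalgebra ℂ C(X, ℂ)} (hB : IsClosed (B : Set C(X, ℂ))) {g : C(X, ℂ)} (hg : g ∈ B)
    (hre : ∀ x, (g x).re ≠ 0) : ∃ e ∈ B, ∀ x, e x = if 0 < (g x).re then 1 else -1 := by
  have hgre : Continuous fun x => (g x).re := by fun_prop
  have hclopen : IsClopen {x | 0 < (g x).re} := by
    refine ⟨?_, isOpen_lt continuous_const hgre⟩
    have : {x | 0 < (g x).re} = {x | 0 ≤ (g x).re} := by
      ext x
      simp only [mem_ofPred_eq, le_iff_lt_or_eq, (hre x).symm, or_false]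
    rw [this]
    exact isClosed_le continuous_const hgre
  let σ : C(X, ℂ) := ⟨fun x => if 0 < (g x).re then 1 else -1, by
    refine continuous_const.if ?_ continuous_const
    intro x hx
    rw [hclopen.frontier_eq] at hx
    exact hx.elim⟩
  have hσ : ∀ x, σ x = if 0 < (g x).re then 1 else -1 := fun x => rfl
  have hσσ : ∀ x, σ x = 1 ∨ σ x = -1 := fun x => by
    rw [hσ]; split_ifs <;> simp
  have hpos : ∀ x, 0 < (σ x * g x).re := fun x => by
    rw [hσ]
    split_ifs with h
    · simpa using h
    · simpa using lt_of_le_of_ne (not_lt.1 h) (hre x)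
  let w : X → ℂ := fun x => (σ x * g x - 1) / (σ x * g x + 1)
  have hne : ∀ x, σ x * g x + 1 ≠ 0 := fun x h => by
    have := congrArg Complex.re h
    have := hpos x
    simp only [Complex.add_re, Complex.one_re, Complex.zero_re] at *
    linarith
  have hw : Continuous w := by
    refine Continuous.div ?_ ?_ hne <;> fun_prop
  have hw1 : ∀ x, ‖w x‖ < 1 := fun x => norm_sub_one_div_add_one_lt_one (hpos x)
  have hpow : ∀ n x, ‖w x ^ 2 ^ n‖ < 1 := fun n x => by
    rw [norm_pow]
    exact pow_lt_one₀ (norm_nonneg _) (hw1 x) (by positivity)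
  have hsub : ∀ n x, 1 - w x ^ 2 ^ n ≠ 0 := fun n x h => by
    have := hpow n x
    rw [← sub_eq_zero.1 h] at this
    simp at this
  have hiter : ∀ n : ℕ, ∃ k ∈ B, ∀ x, k x = σ x * ((1 + w x ^ 2 ^ n) / (1 - w x ^ 2 ^ n)) := by
    intro n
    induction n with
    | zero =>
      refine ⟨g, hg, fun x => ?_⟩
      have h1 := hsub 0 x
      have h2 : (1 + w x ^ 2 ^ 0) / (1 - w x ^ 2 ^ 0) = σ x * g x := by
        rw [div_eq_iff h1]
        simp only [w, pow_zero, pow_one]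
        field_simp [hne x]
        ring
      rw [h2, ← mul_assoc]
      rcases hσσ x with h | h <;> simp [h]
    | succ n ih =>
      obtain ⟨k, hk, hkx⟩ := ih
      have hkre : ∀ x, (k x).re ≠ 0 := fun x => by
        have := re_one_add_div_one_sub_pos (hpow n x)
        rw [hkx]
        rcases hσσ x with h | h
        · rw [h, one_mul]; exact this.ne'
        · rw [h, neg_one_mul, Complex.neg_re]; exact (neg_neg_of_pos this).ne
      obtain ⟨j, hj, hjx⟩ := exists_mem_eq_inv_of_re_ne_zero hB hk hkre
      refine ⟨(1 / 2 : ℂ) • (k + j), B.smul_mem (B.add_mem hk hj) _, fun x => ?_⟩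
      have h1 := hsub n x
      have h2 := hsub (n + 1) x
      have h3 : 1 + w x ^ 2 ^ n ≠ 0 := fun h => by
        have := re_one_add_div_one_sub_pos (hpow n x)
        simp [h] at this
      have h4 : w x ^ 2 ^ (n + 1) = (w x ^ 2 ^ n) ^ 2 := by rw [← pow_mul, pow_succ]
      have h5 : (σ x)⁻¹ = σ x := by rcases hσσ x with h | h <;> simp [h]
      simp only [ContinuousMap.smul_apply, ContinuousMap.add_apply, smul_eq_mul, hjx, hkx,
        mul_inv, h5]
      rw [h4] at h2 ⊢
      generalize w x ^ 2 ^ n = W at h1 h2 h3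
      field_simp
      ring
  refine ⟨σ, ?_, hσ⟩
  rcases isEmpty_or_nonempty X with hX | hX
  · convert hg
    ext x
    exact hX.elim x
  obtain ⟨x₀, -, hx₀⟩ := isCompact_univ.exists_isMaxOn univ_nonempty hw.norm.continuousOn
  set q := ‖w x₀‖
  have hq1 : q < 1 := hw1 x₀
  have hq0 : 0 ≤ q := norm_nonneg _
  choose k hk hkx using hiter
  refine hB.mem_of_tendsto (f := k) (b := Filter.atTop) ?_ (Filter.Eventually.of_forall hk)
  have hbound : ∀ n, ‖k n - σ‖ ≤ 2 * q ^ 2 ^ n / (1 - q) := fun n => by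
    have h1q : 0 < 1 - q := by linarith
    refine (ContinuousMap.norm_le _ (by positivity)).2 fun x => ?_
    have hn : ‖w x ^ 2 ^ n‖ ≤ q ^ 2 ^ n := by
      rw [norm_pow]
      exact pow_le_pow_left₀ (norm_nonneg _) (hx₀ (mem_univ x)) _
    have hle : q ^ 2 ^ n ≤ q := pow_le_of_le_one hq0 hq1.le (by positivity)
    have h1 := hsub n x
    have heq : (k n - σ) x = σ x * (2 * w x ^ 2 ^ n / (1 - w x ^ 2 ^ n)) := by
      rw [ContinuousMap.sub_apply, hkx]
      field_simp
      ring
    have hσn : ‖σ x‖ = 1 := by rcases hσσ x with h | h <;> simp [h]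
    have hden : 1 - q ≤ ‖1 - w x ^ 2 ^ n‖ := by
      have := norm_sub_norm_le (1 : ℂ) (w x ^ 2 ^ n)
      rw [norm_one] at this
      linarith
    rw [heq, norm_mul, hσn, one_mul, norm_div, norm_mul, Complex.norm_ofNat]
    gcongr
  rw [tendsto_iff_norm_sub_tendsto_zero]
  refine squeeze_zero (fun _ => norm_nonneg _) hbound ?_
  have h2 : Filter.Tendsto (fun n : ℕ => q ^ 2 ^ n) Filter.atTop (𝓝 0) :=
    (tendsto_pow_atTop_nhds_zero_of_lt_one hq0 hq1).comp
      (tendsto_pow_atTop_atTop_of_one_lt one_lt_two)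
  simpa using (h2.const_mul 2).div_const (1 - q)

/-! ### Jumps in compact ordered spaces -/

section Jumps

variable {H : Type*} [LinearOrder H] [TopologicalSpace H] [OrderTopology H] [CompactSpace H]

theorem finite_covBy_dist_ge {E : Type*} [PseudoMetricSpace E] {f : H → E} (hf : Continuous f)
    {ε : ℝ} (hε : 0 < ε) : {p : H × H | p.1 ⋖ p.2 ∧ ε ≤ dist (f p.1) (f p.2)}.Finite := by
  set S := {p : H × H | p.1 ⋖ p.2 ∧ ε ≤ dist (f p.1) (f p.2)} with hS
  have hinj : InjOn Prod.fst S := fun p hp q hq h => by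
    refine Prod.ext h ?_
    have h1 := hp.1
    rw [h] at h1
    exact h1.unique_right hq.1
  refine Set.Finite.of_finite_image (f := Prod.fst) ?_ hinj
  by_contra hinf
  obtain ⟨p, hp⟩ := Set.Infinite.exists_accPt_principal hinf
  have hN : ordConnectedComponent {z | dist (f z) (f p) < ε / 2} p ∈ 𝓝 p := by
    rw [ordConnectedComponent_mem_nhds]
    exact hf.continuousAt.eventually (Metric.ball_mem_nhds (f p) (half_pos hε))
  obtain ⟨y, hy, hyp⟩ := accPt_iff_nhds.1 hp _ hN
  obtain ⟨y', hy', -⟩ := accPt_iff_nhds.1 hp _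
    (Filter.inter_mem hN (isOpen_ne.mem_nhds hyp.symm))
  obtain ⟨x, ⟨hxN, ⟨x, x'⟩, hx, rfl⟩, z, ⟨hzN, -⟩, hxz⟩ :=
    Set.Nontrivial.exists_lt ⟨y, hy, y', ⟨hy'.1.1, hy'.2⟩, Ne.symm hy'.1.2⟩
  have hx'z : x' ≤ z := hx.1.ge_of_gt hxz
  have hoc : OrdConnected (ordConnectedComponent {z | dist (f z) (f p) < ε / 2} p) := inferInstance
  have hx'N := ordConnectedComponent_subset (hoc.out hxN hzN ⟨hx.1.le, hx'z⟩)
  have h1 : x ∈ {z | dist (f z) (f p) < ε / 2} := ordConnectedComponent_subset hxN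
  replace h1 : dist (f x) (f p) < ε / 2 := h1
  have h2 : dist (f x') (f p) < ε / 2 := hx'N
  have h3 : ε ≤ dist (f x) (f x') := hx.2
  linarith [dist_triangle_right (f x) (f x') (f p)]

theorem countable_covBy_ne {E : Type*} [MetricSpace E] {f : H → E} (hf : Continuous f) :
    {p : H × H | p.1 ⋖ p.2 ∧ f p.1 ≠ f p.2}.Countable := by
  have : {p : H × H | p.1 ⋖ p.2 ∧ f p.1 ≠ f p.2} ⊆
      ⋃ n : ℕ, {p : H × H | p.1 ⋖ p.2 ∧ 1 / ((n : ℝ) + 1) ≤ dist (f p.1) (f p.2)} := by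
    rintro p ⟨h1, h2⟩
    obtain ⟨n, hn⟩ := exists_nat_one_div_lt (dist_pos.2 h2)
    exact mem_iUnion.2 ⟨n, h1, hn.le⟩
  exact (countable_iUnion fun n =>
    (finite_covBy_dist_ge hf Nat.one_div_pos_of_nat).countable).mono this

/-- A family of points in a second-countable space, indexed by an uncountable type, accumulates at
one of its members. -/
theorem exists_forall_nhds_exists_ne {J T : Type*} [Uncountable J] [TopologicalSpace T]
    [SecondCountableTopology T] (Y : J → T) : ∃ i, ∀ U ∈ 𝓝 (Y i), ∃ j ≠ i, Y j ∈ U := by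
  by_contra! h
  choose U hU hUY using h
  let : TopologicalSpace J := .induced Y ‹_›
  have : SecondCountableTopology J := TopologicalSpace.secondCountableTopology_induced J T Y
  have hYc : Continuous Y := continuous_induced_dom
  obtain ⟨s, hs, hcov⟩ := TopologicalSpace.countable_cover_nhds
    (f := fun i => Y ⁻¹' U i) fun i => hYc.continuousAt.preimage_mem_nhds (hU i)
  have hsub : (univ : Set J) ⊆ s := fun j _ => by
    have hj : j ∈ ⋃ i ∈ s, Y ⁻¹' U i := hcov ▸ mem_univ j
    obtain ⟨i, his, hji⟩ := mem_iUnion₂.1 hj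
    by_cases hne : j = i
    · exact hne ▸ his
    · exact absurd hji (hUY i j hne)
  exact not_countable_univ (hs.mono hsub)

/-- Let `π` be a continuous map to a second-countable space whose fibres are single points or pairs
of neighbours, and suppose that uncountably many pairs of neighbours `p.1 ⋖ p.2` are identified by
`π`. If a continuous function `F p` with `F p p.1 = 0` and `F p p.2 = 1` is given for each of them,
then for some two of these pairs, the real part of `F p - F q` skips a value.

The compact sets `{(π x, F p x)}` are points of the second-countable Vietoris space, so some pair
`p` is a limit of other pairs `q`. The numbers `(F p x - F p y).re` with `π x = π y` form a
countable set, because `F p` has countably many jumps; hence some `s` between `1 / 3` and `2 / 3` has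
neither `s` nor `-s` in that set. For `q` near `p`, the values of `(F p - F q).re` avoid `s` and `-s`, but
one of them is near `0` and another one is near `1` or near `-1`. -/
theorem exists_re_sub_ne_of_uncountable {M : Type*} [TopologicalSpace M] [T2Space M]
    [SecondCountableTopology M] {π : H → M} (hπ : Continuous π)
    (hfib : ∀ x y, x < y → π x = π y → x ⋖ y)
    {J : Set (H × H)} (hJ : ¬ J.Countable) (hJπ : ∀ p : J, p.1.1 ⋖ p.1.2 ∧ π p.1.1 = π p.1.2)
    (F : J → C(H, ℂ))
    (hF0 : ∀ p, F p p.1.1 = 0) (hF1 : ∀ p, F p p.1.2 = 1) :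
    ∃ p q, ∃ s : ℝ, (∀ x, (F p x - F q x).re ≠ s) ∧ (∃ x, (F p x - F q x).re < s) ∧
      ∃ x, s < (F p x - F q x).re := by
  have : Uncountable J := by rwa [← not_countable_iff, countable_coe_iff]
  let G : J → TopologicalSpace.Compacts (M × ℂ) := fun p =>
    ⟨range fun x => (π x, F p x), isCompact_range (by fun_prop)⟩
  obtain ⟨p, hp⟩ := exists_forall_nhds_exists_ne fun p : J => (π p.1.1, G p)
  -- the countably many values of `(F p x - F p y).re` on the fibres of `π`
  let S : Set ℝ := insert 0 ((fun r : H × H => |(F p r.1 - F p r.2).re|) ''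
    {r : H × H | r.1 ⋖ r.2 ∧ F p r.1 ≠ F p r.2})
  have hS : S.Countable := ((countable_covBy_ne (F p).continuous).image _).insert 0
  have hmemS : ∀ x y, π x = π y → |(F p x - F p y).re| ∈ S := fun x y hxy => by
    rcases eq_or_ne (F p x) (F p y) with h | h
    · left; simp [h]
    right
    rcases lt_trichotomy x y with hlt | rfl | hlt
    · exact ⟨(x, y), ⟨hfib x y hlt hxy, h⟩, rfl⟩
    · exact absurd rfl h
    · refine ⟨(y, x), ⟨hfib y x hlt hxy.symm, h.symm⟩, ?_⟩
      simp only
      rw [← abs_neg, ← Complex.neg_re, neg_sub]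
  obtain ⟨s, hsS, hs1, hs2⟩ := (hS.dense_compl ℝ).exists_between
    (show (1 / 3 : ℝ) < 2 / 3 by norm_num)
  -- `F q` is close to `F p` when its graph over `π` avoids the closed set `C`
  let C : Set (M × ℂ) := {mz | ∃ x, π x = mz.1 ∧ |(F p x - mz.2).re| = s}
  have hC : IsClosed C := by
    have h1 : IsClosed {r : H × (M × ℂ) | π r.1 = r.2.1 ∧ |(F p r.1 - r.2.2).re| = s} :=
      (isClosed_eq (by fun_prop) (by fun_prop)).inter (isClosed_eq (by fun_prop) (by fun_prop))
    convert isClosedMap_snd_of_compactSpace _ h1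
    ext mz
    simp [C]
  have hGC : G p ∈ {K : TopologicalSpace.Compacts (M × ℂ) | (K : Set (M × ℂ)) ⊆ Cᶜ} := by
    rintro _ ⟨y, rfl⟩ ⟨x, hxy, hx⟩
    exact hsS (hx ▸ hmemS x y hxy)
  have hGnhds := (TopologicalSpace.Compacts.isOpen_subsets_of_isOpen hC.isOpen_compl).mem_nhds hGC
  -- near `π p.1`, the function `F p` is close to `0` on the left and close to `1` on the right
  let N₀ : Set M := π '' {x | x ≤ p.1.1 ∧ 1 / 3 ≤ ‖F p x‖}
  let N₁ : Set M := π '' {x | p.1.2 ≤ x ∧ 1 / 3 ≤ ‖1 - F p x‖}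
  have hN₀ : IsClosed N₀ := by
    have h1 : IsClosed {x | 1 / 3 ≤ ‖F p x‖} := isClosed_le (by fun_prop) (by fun_prop)
    exact ((isClosed_Iic.inter h1).isCompact.image hπ).isClosed
  have hN₁ : IsClosed N₁ := by
    have h1 : IsClosed {x | 1 / 3 ≤ ‖1 - F p x‖} := isClosed_le (by fun_prop) (by fun_prop)
    exact ((isClosed_Ici.inter h1).isCompact.image hπ).isClosed
  have hp₀ : π p.1.1 ∉ N₀ := by
    rintro ⟨x, ⟨hx, hxF⟩, hxp⟩
    rcases hx.lt_or_eq with hlt | rfl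
    · exact (hfib x p.1.2 (hlt.trans (hJπ p).1.lt) (hxp.trans (hJπ p).2)).2 hlt (hJπ p).1.lt
    · rw [hF0, norm_zero] at hxF
      norm_num at hxF
  have hp₁ : π p.1.1 ∉ N₁ := by
    rintro ⟨x, ⟨hx, hxF⟩, hxp⟩
    rcases hx.lt_or_eq with hlt | rfl
    · exact (hfib p.1.1 x ((hJπ p).1.lt.trans hlt) hxp.symm).2 (hJπ p).1.lt hlt
    · rw [hF1, sub_self, norm_zero] at hxF
      norm_num at hxF
  obtain ⟨q, hqp, ⟨hq₀, hq₁⟩, hqG⟩ := hp _ (prod_mem_nhds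
    (Filter.inter_mem (hN₀.isOpen_compl.mem_nhds hp₀) (hN₁.isOpen_compl.mem_nhds hp₁)) hGnhds)
  have hne : ∀ x, |(F p x - F q x).re| ≠ s := fun x hx =>
    hqG (mem_range_self x) ⟨x, rfl, hx⟩
  have hs0 : 0 ≤ s := by linarith
  have hlow : ∀ x, x ≤ p.1.1 → π x = π q.1.1 → |(F p x).re| < 1 / 3 := fun x hx hxq => by
    refine (Complex.abs_re_le_norm _).trans_lt (not_le.1 fun h => hq₀ ?_)
    exact ⟨x, ⟨hx, h⟩, hxq⟩
  have hhigh : ∀ x, p.1.2 ≤ x → π x = π q.1.1 → |(1 - F p x).re| < 1 / 3 := fun x hx hxq => by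
    refine (Complex.abs_re_le_norm _).trans_lt (not_le.1 fun h => hq₁ ?_)
    exact ⟨x, ⟨hx, h⟩, hxq⟩
  rcases lt_trichotomy q.1.1 p.1.1 with hlt | heq | hlt
  · have hle : q.1.2 ≤ p.1.1 := (hJπ q).1.ge_of_gt hlt
    refine ⟨p, q, -s, fun x hx => hne x ?_, ⟨q.1.2, ?_⟩, ⟨q.1.1, ?_⟩⟩
    · rw [hx, abs_neg, abs_of_nonneg hs0]
    · have := abs_lt.1 (hlow _ hle (hJπ q).2.symm)
      rw [hF1, Complex.sub_re, Complex.one_re]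
      linarith
    · have := abs_lt.1 (hlow _ hlt.le rfl)
      rw [hF0, sub_zero]
      linarith
  · refine absurd (Subtype.ext (Prod.ext heq ?_)) hqp
    have h1 := (hJπ q).1
    rw [heq] at h1
    exact h1.unique_right (hJπ p).1
  · have hle : p.1.2 ≤ q.1.1 := (hJπ p).1.ge_of_gt hlt
    refine ⟨p, q, s, fun x hx => hne x ?_, ⟨q.1.2, ?_⟩, ⟨q.1.1, ?_⟩⟩
    · rw [hx, abs_of_nonneg hs0]
    · have := abs_lt.1 (hhigh _ (hle.trans (hJπ q).1.le) (hJπ q).2.symm)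
      rw [Complex.sub_re, Complex.one_re] at this
      rw [hF1, Complex.sub_re, Complex.one_re]
      linarith
    · have := abs_lt.1 (hhigh _ hle rfl)
      rw [Complex.sub_re, Complex.one_re] at this
      rw [hF0, sub_zero]
      linarith

end Jumps

/-! ### Functionals of full support -/

/-- A functional on `C(H, ℂ)` has full support if every non-empty open set carries a function on
which it does not vanish. -/
def HasFullSupport {H : Type*} [TopologicalSpace H] [CompactSpace H]
    (Λ : C(H, ℂ) →L[ℂ] ℂ) : Prop :=
  ∀ U : Set H, IsOpen U → U.Nonempty → ∃ g : C(H, ℂ), (∀ x ∉ U, g x = 0) ∧ Λ g ≠ 0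

section TotalVariation

variable {H : Type*} [TopologicalSpace H] [CompactSpace H]

/-- The norm of the restriction of `Λ` to the functions that vanish outside `U`, that is, the total
variation on `U` of the measure that represents `Λ`. -/
noncomputable def variationOn (Λ : C(H, ℂ) →L[ℂ] ℂ) (U : Set H) : ℝ :=
  sSup ((fun g : C(H, ℂ) => ‖Λ g‖) '' {g | (∀ x ∉ U, g x = 0) ∧ ‖g‖ ≤ 1})

theorem bddAbove_variationOn (Λ : C(H, ℂ) →L[ℂ] ℂ) (U : Set H) :
    BddAbove ((fun g : C(H, ℂ) => ‖Λ g‖) '' {g | (∀ x ∉ U, g x = 0) ∧ ‖g‖ ≤ 1}) := by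
  refine ⟨‖Λ‖, ?_⟩
  rintro _ ⟨g, hg, rfl⟩
  exact (Λ.le_opNorm g).trans (mul_le_of_le_one_right (norm_nonneg _) hg.2)

theorem norm_le_variationOn (Λ : C(H, ℂ) →L[ℂ] ℂ) {U : Set H} {g : C(H, ℂ)}
    (hg : ∀ x ∉ U, g x = 0) (hg1 : ‖g‖ ≤ 1) : ‖Λ g‖ ≤ variationOn Λ U :=
  le_csSup (bddAbove_variationOn Λ U) ⟨g, ⟨hg, hg1⟩, rfl⟩

theorem variationOn_le {Λ : C(H, ℂ) →L[ℂ] ℂ} {U : Set H} {r : ℝ}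
    (h : ∀ g : C(H, ℂ), (∀ x ∉ U, g x = 0) → ‖g‖ ≤ 1 → ‖Λ g‖ ≤ r) : variationOn Λ U ≤ r := by
  refine csSup_le ⟨‖Λ 0‖, 0, by simp, rfl⟩ ?_
  rintro _ ⟨g, hg, rfl⟩
  exact h g hg.1 hg.2

theorem variationOn_nonneg (Λ : C(H, ℂ) →L[ℂ] ℂ) (U : Set H) : 0 ≤ variationOn Λ U := by
  simpa using norm_le_variationOn Λ (U := U) (g := 0) (by simp) (by simp)

theorem variationOn_pos {Λ : C(H, ℂ) →L[ℂ] ℂ} (hΛ : HasFullSupport Λ) {U : Set H} (hU : IsOpen U)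
    (hne : U.Nonempty) : 0 < variationOn Λ U := by
  obtain ⟨g, hg, hΛg⟩ := hΛ U hU hne
  have hg0 : g ≠ 0 := fun h => hΛg (by simp [h])
  have h0 : 0 < ‖g‖ := norm_pos_iff.2 hg0
  refine lt_of_lt_of_le ?_ (norm_le_variationOn Λ (g := ((‖g‖⁻¹ : ℝ) : ℂ) • g) ?_ ?_)
  · rw [map_smul]
    exact norm_pos_iff.2 (smul_ne_zero (by exact_mod_cast (inv_pos.2 h0).ne') hΛg)
  · intro x hx
    simp [hg x hx]
  · rw [norm_smul, Complex.norm_real, norm_inv, norm_norm, inv_mul_cancel₀ h0.ne']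

theorem exists_norm_le_one_mul_eq_norm (z : ℂ) : ∃ c : ℂ, ‖c‖ ≤ 1 ∧ c * z = ‖z‖ := by
  rcases eq_or_ne z 0 with rfl | hz
  · exact ⟨0, by simp⟩
  · have h0 : (‖z‖ : ℂ) ≠ 0 := by exact_mod_cast (norm_pos_iff.2 hz).ne'
    exact ⟨‖z‖ / z, by simp [norm_pos_iff.2 hz |>.ne'], by field_simp⟩

theorem variationOn_add_le (Λ : C(H, ℂ) →L[ℂ] ℂ) {U V W : Set H} (hUV : Disjoint U V)
    (hUW : U ⊆ W) (hVW : V ⊆ W) : variationOn Λ U + variationOn Λ V ≤ variationOn Λ W := by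
  rw [← le_sub_iff_add_le]
  refine variationOn_le fun g hg hg1 => ?_
  rw [le_sub_iff_add_le', ← le_sub_iff_add_le]
  refine variationOn_le fun k hk hk1 => ?_
  rw [le_sub_iff_add_le]
  obtain ⟨c, hc, hcg⟩ := exists_norm_le_one_mul_eq_norm (Λ g)
  obtain ⟨d, hd, hdk⟩ := exists_norm_le_one_mul_eq_norm (Λ k)
  have hval : Λ (c • g + d • k) = ((‖Λ g‖ + ‖Λ k‖ : ℝ) : ℂ) := by
    simp [hcg, hdk]
  have hle := norm_le_variationOn Λ (U := W) (g := c • g + d • k) ?_ ?_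
  · rw [hval, Complex.norm_real, Real.norm_of_nonneg (by positivity)] at hle
    linarith
  · intro x hx
    simp [hg x fun h => hx (hUW h), hk x fun h => hx (hVW h)]
  · refine (ContinuousMap.norm_le _ zero_le_one).2 fun x => ?_
    by_cases hx : x ∈ U
    · have hxV : x ∉ V := fun h => hUV.le_bot ⟨hx, h⟩
      have := (g.norm_coe_le_norm x).trans hg1
      rw [ContinuousMap.add_apply, ContinuousMap.smul_apply, ContinuousMap.smul_apply, hk x hxV,
        smul_zero, add_zero, smul_eq_mul, norm_mul]
      exact mul_le_one₀ hc (norm_nonneg _) this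
    · have := (k.norm_coe_le_norm x).trans hk1
      rw [ContinuousMap.add_apply, ContinuousMap.smul_apply, ContinuousMap.smul_apply, hg x hx,
        smul_zero, zero_add, smul_eq_mul, norm_mul]
      exact mul_le_one₀ hd (norm_nonneg _) this

theorem variationOn_mono (Λ : C(H, ℂ) →L[ℂ] ℂ) {U W : Set H} (h : U ⊆ W) :
    variationOn Λ U ≤ variationOn Λ W := by
  have := variationOn_add_le Λ (disjoint_empty U) h (empty_subset W)
  linarith [variationOn_nonneg Λ ∅]

theorem sum_variationOn_singleton_le [DecidableEq H] (Λ : C(H, ℂ) →L[ℂ] ℂ) (s : Finset H) :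
    ∑ x ∈ s, variationOn Λ {x} ≤ variationOn Λ s := by
  induction s using Finset.induction_on with
  | empty => simpa using variationOn_nonneg Λ ∅
  | insert a s ha ih =>
    rw [Finset.sum_insert ha]
    refine (add_le_add_right ih _).trans (variationOn_add_le Λ ?_ ?_ ?_)
    · simpa using ha
    · simp
    · simp

theorem HasFullSupport.countable_isolated {Λ : C(H, ℂ) →L[ℂ] ℂ} (hΛ : HasFullSupport Λ) :
    {x : H | IsOpen {x}}.Countable := by
  classical
  have hsum : Summable fun x => variationOn Λ {x} :=
    summable_of_sum_le (c := variationOn Λ univ) (fun x => variationOn_nonneg Λ _) fun s =>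
      (sum_variationOn_singleton_le Λ s).trans (variationOn_mono Λ (subset_univ _))
  refine hsum.countable_support.mono fun x hx => ?_
  exact (variationOn_pos hΛ hx (singleton_nonempty x)).ne'

end TotalVariation

theorem isClopen_Iic_of_covBy {H : Type*} [LinearOrder H] [TopologicalSpace H] [OrderTopology H]
    {x y : H} (h : x ⋖ y) : IsClopen (Iic x) := by
  refine ⟨isClosed_Iic, ?_⟩
  rw [← h.Iio_eq]
  exact isOpen_Iio

theorem isClopen_Iic_of_isOpen_singleton {H : Type*} [LinearOrder H] [TopologicalSpace H]
    [OrderTopology H] {x : H} (h : IsOpen {x}) : IsClopen (Iic x) := by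
  refine ⟨isClosed_Iic, ?_⟩
  rw [← Iio_insert, insert_eq]
  exact h.union isOpen_Iio

theorem exists_continuous_eq_one_zero_of_isClopen {X : Type*} [TopologicalSpace X] {s : Set X}
    (hs : IsClopen s) : ∃ u : C(X, ℝ), (∀ x ∈ s, u x = 1) ∧ ∀ x ∉ s, u x = 0 := by
  classical
  refine ⟨⟨fun x => if x ∈ s then 1 else 0, ?_⟩, fun x hx => if_pos hx, fun x hx => if_neg hx⟩
  refine continuous_const.if (fun x hx => ?_) continuous_const
  have hx' : x ∈ frontier s := hx
  simp [hs.frontier_eq] at hx'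

section OrderedSpace

variable {H : Type*} [LinearOrder H] [TopologicalSpace H] [OrderTopology H] [CompactSpace H]

/-- The variation of a functional of full support on the initial segments of `H` is a function that
identifies at most two neighbouring points. -/
theorem HasFullSupport.exists_monotone {Λ : C(H, ℂ) →L[ℂ] ℂ} (hΛ : HasFullSupport Λ) :
    ∃ φ : H → ℝ, Monotone φ ∧ ∀ a b c, a < b → b < c → φ a < φ c := by
  refine ⟨fun x => variationOn Λ (Iio x), fun a b hab => variationOn_mono Λ (Iio_subset_Iio hab),
    fun a b c hab hbc => ?_⟩
  have h1 : 0 < variationOn Λ (Ioo a c) := variationOn_pos hΛ isOpen_Ioo ⟨b, hab, hbc⟩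
  have h2 : variationOn Λ (Iio a) + variationOn Λ (Ioo a c) ≤ variationOn Λ (Iio c) :=
    variationOn_add_le Λ (disjoint_left.2 fun x hx hx' => lt_asymm hx hx'.1)
      (Iio_subset_Iio (hab.trans hbc).le) Ioo_subset_Iio_self
  linarith

/-- A compact ordered space that carries a functional of full support has a countable family of
continuous functions that separates any two points which are not neighbours. -/
theorem HasFullSupport.exists_countable_family {Λ : C(H, ℂ) →L[ℂ] ℂ} (hΛ : HasFullSupport Λ) :
    ∃ 𝓕 : Set C(H, ℝ), 𝓕.Countable ∧ ∀ x y, x < y → (∀ u ∈ 𝓕, u x = u y) → x ⋖ y := by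
  obtain ⟨φ, hmono, hφ⟩ := hΛ.exists_monotone
  -- for levels `p < q` of `φ`, a function that is `0` below `p` and `1` above `q`
  have h1 : ∀ r : ℚ × ℚ, ∃ u : C(H, ℝ),
      Disjoint (closure {x | φ x ≤ r.1}) (closure {x | (r.2 : ℝ) ≤ φ x}) →
        (∀ x, φ x ≤ r.1 → u x = 0) ∧ ∀ x, (r.2 : ℝ) ≤ φ x → u x = 1 := fun r => by
    by_cases h : Disjoint (closure {x | φ x ≤ r.1}) (closure {x | (r.2 : ℝ) ≤ φ x})
    · obtain ⟨u, hu0, hu1, -⟩ := exists_continuous_zero_one_of_isClosed isClosed_closure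
        isClosed_closure h
      exact ⟨u, fun _ => ⟨fun x hx => hu0 (subset_closure hx), fun x hx => hu1 (subset_closure hx)⟩⟩
    · exact ⟨0, fun h' => absurd h' h⟩
  choose u hu using h1
  have h2 : ∀ z : {x : H | IsOpen {x}}, ∃ v : C(H, ℝ),
      (∀ x ∈ Iic (z : H), v x = 1) ∧ ∀ x ∉ Iic (z : H), v x = 0 := fun z =>
    exists_continuous_eq_one_zero_of_isClopen (isClopen_Iic_of_isOpen_singleton z.2)
  choose v hv1 hv0 using h2
  have := hΛ.countable_isolated.to_subtype
  refine ⟨range u ∪ range v, (countable_range u).union (countable_range v), fun x y hxy huv => ?_⟩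
  by_contra hcov
  obtain ⟨z, hz⟩ : (Ioo x y).Nonempty := by
    by_contra hne
    exact hcov ⟨hxy, fun c h1 h2 => hne ⟨c, h1, h2⟩⟩
  rcases (Ioo x y).finite_or_infinite with hfin | hinf
  · -- a finite interval consists of isolated points
    have hopen : IsOpen {z} := by
      have h3 : {z} = Ioo x y \ (Ioo x y \ {z}) := by
        rw [sdiff_sdiff_cancel_left (singleton_subset_iff.2 hz)]
      rw [h3]
      exact isOpen_Ioo.sdiff (hfin.subset sdiff_subset).isClosed
    have h4 := huv _ (Or.inr ⟨⟨z, hopen⟩, rfl⟩)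
    rw [hv1 ⟨z, hopen⟩ x hz.1.le, hv0 ⟨z, hopen⟩ y (not_le.2 hz.2)] at h4
    exact one_ne_zero h4
  · -- levels of `φ` between `x` and the second of four points, and between the third one and `y`
    obtain ⟨t, ht, htc⟩ := hinf.exists_subset_card_eq 4
    let e := t.orderEmbOfFin htc
    have he : ∀ i, e i ∈ Ioo x y := fun i => ht (t.orderEmbOfFin_mem htc i)
    have h01 : e 0 < e 1 := e.lt_iff_lt.2 (by decide)
    have h12 : e 1 < e 2 := e.lt_iff_lt.2 (by decide)
    have h23 : e 2 < e 3 := e.lt_iff_lt.2 (by decide)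
    obtain ⟨p, hp1, hp2⟩ := exists_rat_btwn (hφ _ _ _ (he 0).1 h01)
    obtain ⟨q, hq1, hq2⟩ := exists_rat_btwn (hφ _ _ _ h23 (he 3).2)
    have hlow : closure {x | φ x ≤ ((p, q) : ℚ × ℚ).1} ⊆ Iic (e 1) :=
      closure_minimal (fun w (hw : φ w ≤ p) => le_of_lt <| not_le.1 fun h =>
        absurd (hmono h) (not_le.2 (hw.trans_lt hp2))) isClosed_Iic
    have hhigh : closure {x | (((p, q) : ℚ × ℚ).2 : ℝ) ≤ φ x} ⊆ Ici (e 2) :=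
      closure_minimal (fun w (hw : (q : ℝ) ≤ φ w) => le_of_lt <| not_le.1 fun h =>
        absurd (hmono h) (not_le.2 (hq1.trans_le hw))) isClosed_Ici
    have hdisj : Disjoint (Iic (e 1)) (Ici (e 2)) :=
      disjoint_left.2 fun w hw1 hw2 => absurd (hw2.trans hw1) (not_le.2 h12)
    obtain ⟨hu0, hu1⟩ := hu (p, q) (hdisj.mono hlow hhigh)
    have h4 := huv _ (Or.inl ⟨(p, q), rfl⟩)
    rw [hu0 x hp1.le, hu1 y hq2.le] at h4
    exact zero_ne_one h4

end OrderedSpace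

/-! ### Function algebras on ordered spaces without Cantor subsets -/

theorem ContainsCantorSet.of_embedding {X Y : Type*} [TopologicalSpace X] [TopologicalSpace Y]
    {e : X → Y} (he : IsEmbedding e) (h : ContainsCantorSet X) : ContainsCantorSet Y := by
  obtain ⟨f, hf⟩ := h
  exact ⟨e ∘ f, he.comp hf⟩

theorem containsCantorSet_of_uncountable {X : Type*} [TopologicalSpace X] [PolishSpace X]
    (hX : ¬ Countable X) : ContainsCantorSet X := by
  obtain ⟨f, -, hf, hinj⟩ := isClosed_univ.exists_nat_bool_injection_of_not_countable
    (α := X) (by rwa [countable_univ_iff])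
  exact ⟨f ∘ cantorSetHomeomorphNatToBool,
    (hf.isClosedEmbedding hinj).isEmbedding.comp cantorSetHomeomorphNatToBool.isEmbedding⟩

theorem polishSpace_of_countable_separating {X : Type*} [TopologicalSpace X] [CompactSpace X]
    {𝓕 : Set C(X, ℝ)} (h𝓕 : 𝓕.Countable) (hsep : ∀ x y, (∀ u ∈ 𝓕, u x = u y) → x = y) :
    PolishSpace X := by
  have := h𝓕.to_subtype
  have hcont : Continuous fun (x : X) (u : 𝓕) => (u : C(X, ℝ)) x := by fun_prop
  exact (hcont.isClosedEmbedding fun x y hxy =>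
    hsep x y fun u hu => congrFun hxy ⟨u, hu⟩).polishSpace

section OrderedSpace

variable {H : Type*} [LinearOrder H] [TopologicalSpace H] [OrderTopology H] [CompactSpace H]

/-- On a compact ordered space without Cantor subsets that carries a functional of full support,
a separating function algebra in which the real part of each element has a connected range is
trivial.

If the countable family of `HasFullSupport.exists_countable_family` leaves uncountably many pairs of
neighbours unseparated, then `exists_re_sub_ne_of_uncountable` yields an element whose real part
skips a value. Otherwise the space is metrizable, hence countable, so that countable connected
ranges leave only the constants. -/
theorem subsingleton_of_re_connected (hcantor : ¬ ContainsCantorSet H) {Λ : C(H, ℂ) →L[ℂ] ℂ}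
    (hΛ : HasFullSupport Λ) {B : Subalgebra ℂ C(H, ℂ)} (hsep : B.SeparatesPoints)
    (hconn : ∀ g ∈ B, ∀ s : ℝ, (∀ x, (g x).re ≠ s) → (∀ x, (g x).re < s) ∨ ∀ x, s < (g x).re) :
    Subsingleton H := by
  obtain ⟨𝓕, h𝓕, hfib⟩ := hΛ.exists_countable_family
  have := h𝓕.to_subtype
  let π : H → 𝓕 → ℝ := fun x u => (u : C(H, ℝ)) x
  have hπ : Continuous π := by fun_prop
  let J : Set (H × H) := {p | p.1 ⋖ p.2 ∧ π p.1 = π p.2}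
  by_cases hJ : J.Countable
  · have := hJ.to_subtype
    have h1 : ∀ p : J, ∃ v : C(H, ℝ), (∀ x ∈ Iic p.1.1, v x = 1) ∧ ∀ x ∉ Iic p.1.1, v x = 0 :=
      fun p => exists_continuous_eq_one_zero_of_isClopen (isClopen_Iic_of_covBy p.2.1)
    choose v hv1 hv0 using h1
    have hne : ∀ x y, x < y → ¬ ∀ u ∈ 𝓕 ∪ range v, u x = u y := fun x y hxy huv => by
      have hcov : x ⋖ y := hfib x y hxy fun u hu => huv u (Or.inl hu)
      have hmem : (x, y) ∈ J := ⟨hcov, funext fun u => huv u (Or.inl u.2)⟩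
      have h2 := huv _ (Or.inr ⟨⟨(x, y), hmem⟩, rfl⟩)
      rw [hv1 ⟨(x, y), hmem⟩ x le_rfl, hv0 ⟨(x, y), hmem⟩ y (not_le.2 hxy)] at h2
      exact one_ne_zero h2
    have : PolishSpace H := by
      refine polishSpace_of_countable_separating (h𝓕.union (countable_range v)) fun x y hxy => ?_
      rcases lt_trichotomy x y with h | h | h
      · exact absurd hxy (hne x y h)
      · exact h
      · exact absurd (fun u hu => (hxy u hu).symm) (hne y x h)
    have hctble : Countable H := by
      by_contra h
      exact hcantor (containsCantorSet_of_uncountable h)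
    have hre : ∀ g ∈ B, ∀ x y, ¬ (g x).re < (g y).re := fun g hg x y hxy => by
      obtain ⟨s, hs, hxs, hsy⟩ :=
        ((countable_range fun z => (g z).re).dense_compl ℝ).exists_between hxy
      rcases hconn g hg s fun z hz => hs ⟨z, hz⟩ with h | h
      · exact lt_asymm (h y) hsy
      · exact lt_asymm (h x) hxs
    have hre' : ∀ g ∈ B, ∀ x y, (g x).re = (g y).re := fun g hg x y =>
      le_antisymm (not_lt.1 (hre g hg y x)) (not_lt.1 (hre g hg x y))
    refine ⟨fun x y => ?_⟩
    by_contra hxy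
    obtain ⟨_, ⟨g, hg, rfl⟩, hgxy⟩ := hsep hxy
    refine hgxy (Complex.ext (hre' g hg x y) ?_)
    have := hre' _ (B.smul_mem hg Complex.I) x y
    simpa using this
  · have h1 : ∀ p : J, ∃ f ∈ B, f p.1.1 = 0 ∧ f p.1.2 = 1 := fun p => by
      obtain ⟨_, ⟨g, hg, rfl⟩, hne⟩ := hsep p.2.1.lt.ne
      have hne' : g p.1.2 - g p.1.1 ≠ 0 := sub_ne_zero.2 (Ne.symm hne)
      refine ⟨(g p.1.2 - g p.1.1)⁻¹ • (g - algebraMap ℂ C(H, ℂ) (g p.1.1)),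
        B.smul_mem (B.sub_mem hg (B.algebraMap_mem _)) _, ?_, ?_⟩
      · simp
      · simp [inv_mul_cancel₀ hne']
    choose F hFB hF0 hF1 using h1
    obtain ⟨p, q, s, hs, ⟨x, hx⟩, ⟨y, hy⟩⟩ := exists_re_sub_ne_of_uncountable hπ
      (fun x y hxy hxy' => hfib x y hxy fun u hu => congrFun hxy' ⟨u, hu⟩) hJ (fun p => p.2) F
      hF0 hF1
    rcases hconn _ (B.sub_mem (hFB p) (hFB q)) s hs with h | h
    · exact absurd (h y) (lt_asymm hy)
    · exact absurd (h x) (lt_asymm hx)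

end OrderedSpace

/-! ### Reduction to a minimal set of bad approximation -/

/-- A function `f` is at distance at least `d` from the algebra `B`, but at distance less than `d`
on every proper closed subset. -/
structure IsCritical {H : Type*} [TopologicalSpace H] (B : Subalgebra ℂ C(H, ℂ)) (f : C(H, ℂ))
    (d : ℝ) : Prop where
  pos : 0 < d
  exists_le : ∀ b ∈ B, ∃ x, d ≤ ‖f x - b x‖
  exists_lt : ∀ K : Set H, IsClosed K → K ≠ univ → ∃ b ∈ B, ∀ x ∈ K, ‖f x - b x‖ < d

namespace IsCritical

variable {H : Type*} [TopologicalSpace H] {B : Subalgebra ℂ C(H, ℂ)} {f : C(H, ℂ)} {d : ℝ}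

theorem not_subsingleton (h : IsCritical B f d) : ¬ Subsingleton H := fun hH => by
  obtain ⟨x, -⟩ := h.exists_le 0 B.zero_mem
  obtain ⟨y, hy⟩ := h.exists_le _ (B.algebraMap_mem (f x))
  rw [Subsingleton.elim y x] at hy
  have := h.pos
  simp at hy
  linarith

variable [CompactSpace H]

/-- An element of `B` whose real part skips a value gives an idempotent of `B`, which glues
approximations of `f` on the two parts into which it cuts the space. -/
theorem re_connected (h : IsCritical B f d) (hB : IsClosed (B : Set C(H, ℂ))) {g : C(H, ℂ)}
    (hg : g ∈ B) {s : ℝ} (hs : ∀ x, (g x).re ≠ s) :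
    (∀ x, (g x).re < s) ∨ ∀ x, s < (g x).re := by
  by_contra! hcon
  obtain ⟨⟨x₁, hx₁⟩, ⟨x₂, hx₂⟩⟩ := hcon
  have hg' : g - algebraMap ℂ C(H, ℂ) s ∈ B := B.sub_mem hg (B.algebraMap_mem _)
  obtain ⟨e, he, hex⟩ := exists_mem_eq_sign_re hB hg' fun x => by
    simpa [sub_eq_zero] using hs x
  have hex' : ∀ x, e x = if s < (g x).re then 1 else -1 := fun x => by simp [hex]
  have hK : ∀ c : ℂ, IsClosed {x | e x = c} := fun c => isClosed_eq (by fun_prop) (by fun_prop)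
  obtain ⟨b₁, hb₁, hfb₁⟩ := h.exists_lt {x | e x = 1} (hK 1) fun huniv => by
    have : x₂ ∈ {x | e x = 1} := huniv ▸ mem_univ x₂
    replace this : e x₂ = 1 := this
    rw [hex', if_neg (not_lt.2 hx₂)] at this
    norm_num at this
  obtain ⟨b₂, hb₂, hfb₂⟩ := h.exists_lt {x | e x = -1} (hK (-1)) fun huniv => by
    have : x₁ ∈ {x | e x = -1} := huniv ▸ mem_univ x₁
    replace this : e x₁ = -1 := this
    rw [hex', if_pos (lt_of_le_of_ne hx₁ (hs x₁).symm)] at this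
    norm_num at this
  obtain ⟨x, hx⟩ := h.exists_le ((1 / 2 : ℂ) • ((1 + e) * b₁ + (1 - e) * b₂))
    (B.smul_mem (B.add_mem (B.mul_mem (B.add_mem B.one_mem he) hb₁)
      (B.mul_mem (B.sub_mem B.one_mem he) hb₂)) _)
  by_cases hxs : s < (g x).re
  · have h1 : e x = 1 := by rw [hex', if_pos hxs]
    have h2 := hfb₁ x h1
    refine absurd hx (not_le.2 ?_)
    have h3 : ((1 / 2 : ℂ) • ((1 + e) * b₁ + (1 - e) * b₂)) x = b₁ x := by
      change (1 / 2 : ℂ) * ((1 + e x) * b₁ x + (1 - e x) * b₂ x) = _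
      rw [h1]
      ring
    rwa [h3]
  · have h1 : e x = -1 := by rw [hex', if_neg hxs]
    have h2 := hfb₂ x h1
    refine absurd hx (not_le.2 ?_)
    have h3 : ((1 / 2 : ℂ) • ((1 + e) * b₁ + (1 - e) * b₂)) x = b₂ x := by
      change (1 / 2 : ℂ) * ((1 + e x) * b₁ x + (1 - e x) * b₂ x) = _
      rw [h1]
      ring
    rwa [h3]

/-- A functional of norm at most one that vanishes on `B` and attains the distance of `f` to `B` at
`f` has full support: if it vanished on the functions carried by an open set `U`, then an approximation of
`f` outside `U` could be improved inside `U` without the functional noticing. -/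
theorem exists_hasFullSupport [T2Space H] (h : IsCritical B f d)
    (hB : IsClosed (B : Set C(H, ℂ))) : ∃ Λ : C(H, ℂ) →L[ℂ] ℂ, HasFullSupport Λ := by
  let V := Subalgebra.toSubmodule B
  have : IsClosed (V : Set C(H, ℂ)) := hB
  obtain ⟨ℓ, hℓ1, hℓf⟩ := exists_dual_vector'' ℂ (Submodule.Quotient.mk (p := V) f)
  let Λ : C(H, ℂ) →L[ℂ] ℂ := (ℓ.toLinearMap ∘ₗ V.mkQ).mkContinuous 1 fun g => by
    refine (ℓ.le_opNorm _).trans (mul_le_mul hℓ1 ?_ (norm_nonneg _) zero_le_one)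
    exact Submodule.Quotient.norm_mk_le V g
  have hΛ : ∀ g, Λ g = ℓ (Submodule.Quotient.mk g) := fun g => rfl
  have hΛle : ∀ g, ‖Λ g‖ ≤ ‖g‖ := fun g => by
    simpa using Λ.le_of_opNorm_le (LinearMap.mkContinuous_norm_le _ zero_le_one _) g
  have hΛB : ∀ b ∈ B, Λ b = 0 := fun b hb => by
    rw [hΛ, (Submodule.Quotient.mk_eq_zero V).2 hb, map_zero]
  have hΛf : d ≤ ‖Λ f‖ := by
    rw [hΛ, hℓf, RCLike.norm_ofReal, abs_norm]
    refine QuotientAddGroup.le_norm_iff.2 fun m hm => ?_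
    have hmV : m - f ∈ B := (Submodule.Quotient.eq V).1 hm
    by_contra! hlt
    obtain ⟨x, hx⟩ := h.exists_le (f - m) (by simpa using B.neg_mem hmV)
    have := m.norm_coe_le_norm x
    simp at hx
    linarith
  refine ⟨Λ, fun U hU hne => ?_⟩
  by_contra! hcon
  obtain ⟨b, hb, hfb⟩ := h.exists_lt Uᶜ hU.isClosed_compl fun hU' => by
    rw [compl_univ_iff] at hU'
    exact hne.ne_empty hU'
  -- a bound `r < d` for `f - b` off `U`
  obtain ⟨r, hr0, hrd, hr⟩ : ∃ r, 0 ≤ r ∧ r < d ∧ ∀ x ∉ U, ‖f x - b x‖ ≤ r := by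
    rcases Uᶜ.eq_empty_or_nonempty with hem | hnem
    · refine ⟨0, le_rfl, h.pos, fun x hx => ?_⟩
      exact absurd (hem ▸ (show x ∈ Uᶜ from hx)) (notMem_empty x)
    · obtain ⟨x₀, hx₀, hmax⟩ := hU.isClosed_compl.isCompact.exists_isMaxOn hnem
        (f := fun x => ‖f x - b x‖) (by fun_prop)
      exact ⟨‖f x₀ - b x₀‖, norm_nonneg _, hfb x₀ hx₀, fun x hx => hmax hx⟩
  obtain ⟨r', hrr', hr'd⟩ := exists_between hrd
  have hdisj : Disjoint Uᶜ {x | r' ≤ ‖f x - b x‖} := disjoint_left.2 fun x hx hx' =>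
    absurd ((hr x hx).trans_lt hrr') (not_lt.2 hx')
  obtain ⟨u, hu0, hu1, hu01⟩ := exists_continuous_zero_one_of_isClosed hU.isClosed_compl
    (isClosed_le continuous_const (by fun_prop)) hdisj
  let v : C(H, ℂ) := ⟨fun x => (u x : ℂ), by fun_prop⟩
  have hv : ∀ x, v x = (u x : ℂ) := fun x => rfl
  have h1 : Λ ((f - b) * v) = 0 := hcon _ fun x hx => by
    have : u x = 0 := hu0 hx
    simp [hv, this]
  have h2 : Λ f = Λ ((f - b) * (1 - v)) := by
    have : f = (f - b) * v + (f - b) * (1 - v) + b := by ring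
    conv_lhs => rw [this, map_add, map_add, h1, hΛB b hb]
    simp
  have h3 : ‖(f - b) * (1 - v)‖ ≤ r' := by
    refine (ContinuousMap.norm_le _ (hr0.trans hrr'.le)).2 fun x => ?_
    have hval : ‖((f - b) * (1 - v)) x‖ = ‖f x - b x‖ * (1 - u x) := by
      rw [ContinuousMap.mul_apply, norm_mul]
      congr 1
      have : (1 - v) x = ((1 - u x : ℝ) : ℂ) := by simp [hv]
      rw [this, Complex.norm_real, Real.norm_of_nonneg (by linarith [(hu01 x).2])]
    rw [hval]
    have h01 := hu01 x
    by_cases hx : r' ≤ ‖f x - b x‖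
    · have : u x = 1 := hu1 hx
      rw [this]
      linarith
    · push Not at hx
      nlinarith [norm_nonneg (f x - b x), h01.1, h01.2]
  have h4 := hΛle ((f - b) * (1 - v))
  rw [← h2] at h4
  linarith

end IsCritical

/-- If `f` is not in the closure of the function algebra `A`, then there is a closed set `H` such
that `f` restricted to `H` is critical for the closure of the restriction of `A`. -/
theorem exists_isCritical {X : Type*} [TopologicalSpace X] [CompactSpace X]
    {A : Subalgebra ℂ C(X, ℂ)} {f : C(X, ℂ)} (hf : f ∉ closure (A : Set C(X, ℂ))) :
    ∃ H : Set X, IsClosed H ∧ ∃ B : Subalgebra ℂ C(H, ℂ), IsClosed (B : Set C(H, ℂ)) ∧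
      (∀ a ∈ A, a.restrict H ∈ B) ∧ ∃ d, IsCritical B (f.restrict H) d := by
  rw [Metric.mem_closure_iff] at hf
  push Not at hf
  obtain ⟨d, hd, hfd⟩ := hf
  let S : Set (Set X) := {H | IsClosed H ∧ ∀ a ∈ A, ∃ x ∈ H, d ≤ ‖f x - a x‖}
  have hclosed : ∀ a : C(X, ℂ), IsClosed {x | d ≤ ‖f x - a x‖} := fun a =>
    isClosed_le continuous_const (by fun_prop)
  have huniv : univ ∈ S := ⟨isClosed_univ, fun a ha => by
    by_contra! hlt
    have := hfd a ha
    rw [dist_eq_norm] at this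
    exact absurd ((ContinuousMap.norm_lt_iff _ hd).2 fun x => hlt x (mem_univ x)) (not_lt.2 this)⟩
  obtain ⟨H, hHS, hmin⟩ := zorn_superset S fun c hcS hc => by
    rcases c.eq_empty_or_nonempty with rfl | hne
    · exact ⟨univ, huniv, by simp⟩
    refine ⟨⋂₀ c, ⟨isClosed_sInter fun s hs => (hcS hs).1, fun a ha => ?_⟩,
      fun s hs => sInter_subset_of_mem hs⟩
    have := hne.to_subtype
    obtain ⟨x, hx⟩ := IsCompact.nonempty_iInter_of_directed_nonempty_isCompact_isClosed
      (fun s : c => (s : Set X) ∩ {x | d ≤ ‖f x - a x‖})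
      (fun s t => by
        rcases hc.total s.2 t.2 with hst | hst
        · exact ⟨s, Subset.rfl, inter_subset_inter_left _ hst⟩
        · exact ⟨t, inter_subset_inter_left _ hst, Subset.rfl⟩)
      (fun s => (hcS s.2).2 a ha)
      (fun s => ((hcS s.2).1.inter (hclosed a)).isCompact)
      (fun s => (hcS s.2).1.inter (hclosed a))
    rw [mem_iInter] at hx
    exact ⟨x, fun s hs => (hx ⟨s, hs⟩).1, (hx ⟨_, hne.some_mem⟩).2⟩
  have : CompactSpace H := isCompact_iff_compactSpace.1 hHS.1.isCompact
  let ρ : C(X, ℂ) →ₐ[ℂ] C(H, ℂ) :=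
    ContinuousMap.compRightAlgHom ℂ ℂ (⟨Subtype.val, continuous_subtype_val⟩ : C(H, X))
  refine ⟨H, hHS.1, (A.map ρ).topologicalClosure, Subalgebra.isClosed_topologicalClosure _,
    fun a ha => subset_closure ⟨a, ha, rfl⟩, d, hd, fun b hb => ?_, fun K hK hKne => ?_⟩
  · have hle : ∀ b ∈ (A.map ρ).topologicalClosure, d ≤ ‖f.restrict H - b‖ := fun b hb => by
      refine closure_minimal (s := (A.map ρ : Set C(H, ℂ))) (t := {b | d ≤ ‖f.restrict H - b‖}) ?_
        (isClosed_le continuous_const (by fun_prop)) hb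
      rintro _ ⟨a, ha, rfl⟩
      obtain ⟨x, hxH, hx⟩ := hHS.2 a ha
      exact hx.trans ((f.restrict H - ρ a).norm_coe_le_norm ⟨x, hxH⟩)
    by_contra! hlt
    exact absurd ((ContinuousMap.norm_lt_iff _ hd).2 hlt) (not_lt.2 (hle b hb))
  · have hKS : Subtype.val '' K ∉ S := fun hKS => hKne <| by
      have hsub := hmin hKS (Subtype.coe_image_subset H K)
      ext x
      refine ⟨fun _ => mem_univ x, fun _ => ?_⟩
      obtain ⟨y, hy, hyx⟩ := hsub x.2
      rwa [← Subtype.ext hyx]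
    have hKcl : IsClosed (Subtype.val '' K) := hHS.1.isClosedEmbedding_subtypeVal.isClosedMap K hK
    simp only [S, mem_ofPred_eq, hKcl, true_and] at hKS
    push Not at hKS
    obtain ⟨a, ha, hlt⟩ := hKS
    exact ⟨ρ a, subset_closure ⟨a, ha, rfl⟩, fun x hx => hlt x ⟨x, hx, rfl⟩⟩

theorem eq_of_le_of_compactSpace_of_t2Space {X : Type*} {t t' : TopologicalSpace X}
    (hc : @CompactSpace X t) (h2 : @T2Space X t') (h : t ≤ t') : t = t' := by
  have hemb := @Continuous.isClosedEmbedding X X t t' hc h2 id (continuous_id_iff_le.2 h)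
    Function.injective_id
  exact (@IsInducing.eq_induced X X t t' id
    (@IsClosedEmbedding.isInducing X X id t t' hemb)).trans induced_id

theorem t2Space_preorderTopology (X : Type*) [LinearOrder X] :
    @T2Space X (Preorder.topology X) := by
  let := Preorder.topology X
  have : OrderTopology X := ⟨rfl⟩
  infer_instance

theorem orderTopology_of_isCompact {X : Type*} [LinearOrder X] [TopologicalSpace X]
    [OrderTopology X] {s : Set X} (hs : IsCompact s) : OrderTopology s := by
  refine ⟨eq_of_le_of_compactSpace_of_t2Space (isCompact_iff_compactSpace.1 hs)
    (t2Space_preorderTopology s) (le_generateFrom ?_)⟩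
  rintro _ ⟨a, rfl | rfl⟩
  · exact isOpen_Ioi.preimage continuous_subtype_val
  · exact isOpen_Iio.preimage continuous_subtype_val

/-- A compact ordered space that contains no Cantor set has the complex Stone–Weierstrass
property. -/
theorem hasCSWP_of_not_containsCantorSet {X : Type*} [LinearOrder X] [TopologicalSpace X]
    [OrderTopology X] [CompactSpace X] (hX : ¬ ContainsCantorSet X) : HasCSWP X := by
  intro A hA f
  by_contra hf
  obtain ⟨H, hH, B, hB, hAB, d, hcrit⟩ := exists_isCritical hf
  have : CompactSpace H := isCompact_iff_compactSpace.1 hH.isCompact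
  have : OrderTopology H := orderTopology_of_isCompact hH.isCompact
  obtain ⟨Λ, hΛ⟩ := hcrit.exists_hasFullSupport hB
  refine hcrit.not_subsingleton (subsingleton_of_re_connected (B := B)
    (fun h => hX (h.of_embedding IsEmbedding.subtypeVal)) hΛ (fun x y hxy => ?_)
    fun g hg s hs => hcrit.re_connected hB hg hs)
  obtain ⟨_, ⟨a, ha, rfl⟩, hne⟩ := hA (Subtype.val_injective.ne hxy)
  exact ⟨_, ⟨_, hAB a ha, rfl⟩, hne⟩

/-! ### The Cauchy transform of a plane set -/

section CauchyTransform

open MeasureTheory Filter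

theorem integrableOn_norm_inv_ball (r : ℝ) :
    IntegrableOn (fun x : ℂ => ‖x‖⁻¹) (Metric.ball 0 r) := by
  rw [integrableOn_fun_norm_addHaar volume (f := fun y => y⁻¹)]
  refine (integrableOn_const (C := (1 : ℝ)) (by simp)).congr_fun (fun y hy => ?_) measurableSet_Ioo
  simp [Complex.finrank_real_complex, hy.1.ne']

theorem integral_ball_norm_inv {r : ℝ} (hr : 0 ≤ r) :
    ∫ x in Metric.ball (0 : ℂ) r, ‖x‖⁻¹ = 2 * (volume.real (Metric.ball (0 : ℂ) 1) * r) := by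
  have h1 : ∀ x : ℂ, (Metric.ball (0 : ℂ) r).indicator (fun x => ‖x‖⁻¹) x =
      (Iio r).indicator (fun y : ℝ => y⁻¹) ‖x‖ := fun x => by
    simp [indicator]
  rw [← integral_indicator measurableSet_ball, integral_congr_ae (Eventually.of_forall h1),
    integral_fun_norm_addHaar volume ((Iio r).indicator fun y : ℝ => y⁻¹),
    setIntegral_congr_fun (g := (Iio r).indicator fun _ => (1 : ℝ)) measurableSet_Ioi]
  · rw [setIntegral_indicator measurableSet_Iio]
    simp [Complex.finrank_real_complex, Ioi_inter_Iio, hr]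
  · intro y hy
    have hy' : y ≠ 0 := (show 0 < y from hy).ne'
    by_cases hyr : y < r <;> simp [Complex.finrank_real_complex, hyr, hy']

/-- The Cauchy transform of the restriction of the Lebesgue measure to `E`. -/
noncomputable def cauchyTransform (E : Set ℂ) (z : ℂ) : ℂ := ∫ w in E, (w - z)⁻¹

variable {E : Set ℂ}

theorem integrableOn_sub_inv (hE : IsCompact E) (z : ℂ) :
    IntegrableOn (fun w => (w - z)⁻¹) E := by
  have h1 : Integrable ((Metric.ball (0 : ℂ) 1).indicator fun x : ℂ => ‖x‖⁻¹) :=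
    (integrableOn_norm_inv_ball 1).integrable_indicator measurableSet_ball
  have h2 : IntegrableOn (fun w : ℂ =>
      (Metric.ball (0 : ℂ) 1).indicator (fun x : ℂ => ‖x‖⁻¹) (w - z) + 1) E :=
    (h1.comp_sub_right z).integrableOn.add (integrableOn_const hE.measure_lt_top.ne)
  refine Integrable.mono h2 (Measurable.aestronglyMeasurable (by fun_prop))
    (Eventually.of_forall fun w => ?_)
  rw [norm_inv, Real.norm_eq_abs]
  refine le_trans ?_ (le_abs_self _)
  by_cases hw : w - z ∈ Metric.ball (0 : ℂ) 1
  · rw [indicator_of_mem hw]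
    linarith
  · rw [indicator_of_notMem hw, zero_add]
    exact inv_le_one_of_one_le₀ (by simpa using hw)

/-- The Cauchy transform is the uniform limit of the convolutions with the continuous kernels
`conj u / max r ‖u‖ ^ 2`. -/
theorem continuous_cauchyTransform (hE : IsCompact E) : Continuous (cauchyTransform E) := by
  let k : ℝ → ℂ → ℂ := fun r u => (starRingEnd ℂ) u / ((max r ‖u‖ ^ 2 : ℝ) : ℂ)
  have hmax : ∀ r : ℝ, 0 < r → ∀ u : ℂ, 0 < max r ‖u‖ ^ 2 := fun r hr u => by positivity
  have hk : ∀ r, 0 < r → Continuous (k r) := fun r hr => by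
    refine Continuous.div (by fun_prop) (by fun_prop) fun u => ?_
    exact_mod_cast (hmax r hr u).ne'
  have hknorm : ∀ r, 0 < r → ∀ u, ‖k r u‖ ≤ r⁻¹ := fun r hr u => by
    simp only [k]
    rw [norm_div, Complex.norm_real, RCLike.norm_conj, Real.norm_of_nonneg (hmax r hr u).le,
      div_le_iff₀ (hmax r hr u), sq, ← mul_assoc]
    have h1 : 1 ≤ r⁻¹ * max r ‖u‖ := by
      rw [inv_mul_eq_div, one_le_div hr]
      exact le_max_left _ _
    calc ‖u‖ ≤ max r ‖u‖ := le_max_right _ _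
      _ ≤ r⁻¹ * max r ‖u‖ * max r ‖u‖ := le_mul_of_one_le_left (by positivity) h1
  have hkdiff : ∀ r, 0 < r → ∀ u : ℂ, ‖u⁻¹ - k r u‖ ≤
      (Metric.ball (0 : ℂ) r).indicator (fun x : ℂ => ‖x‖⁻¹) u := fun r hr u => by
    have hinv : u⁻¹ = (starRingEnd ℂ) u / ((‖u‖ ^ 2 : ℝ) : ℂ) := by
      rw [Complex.inv_def, Complex.normSq_eq_norm_sq, div_eq_mul_inv, Complex.ofReal_inv]
    by_cases hu : u ∈ Metric.ball (0 : ℂ) r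
    · rw [indicator_of_mem hu]
      have hur : ‖u‖ < r := by simpa using hu
      rcases eq_or_ne u 0 with rfl | hu0
      · simp [k]
      have hupos : 0 < ‖u‖ := norm_pos_iff.2 hu0
      have heq : u⁻¹ - k r u =
          (starRingEnd ℂ) u * ((((‖u‖ ^ 2)⁻¹ - (r ^ 2)⁻¹ : ℝ)) : ℂ) := by
        rw [hinv]
        simp only [k, max_eq_left hur.le]
        push_cast
        ring
      have hle : 0 ≤ (‖u‖ ^ 2)⁻¹ - (r ^ 2)⁻¹ := by
        rw [sub_nonneg]
        gcongr
      rw [heq, norm_mul, RCLike.norm_conj, Complex.norm_real, Real.norm_of_nonneg hle, mul_sub]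
      have h2 : ‖u‖ * (‖u‖ ^ 2)⁻¹ = ‖u‖⁻¹ := by field_simp
      rw [h2]
      have : 0 ≤ ‖u‖ * (r ^ 2)⁻¹ := by positivity
      linarith
    · rw [indicator_of_notMem hu]
      have hur : r ≤ ‖u‖ := by simpa using hu
      rw [hinv]
      simp [k, max_eq_right hur]
  have : IsFiniteMeasure (volume.restrict E) := ⟨by simpa using hE.measure_lt_top⟩
  have hkE : ∀ r, 0 < r → ∀ z, IntegrableOn (fun w => k r (w - z)) E := fun r hr z =>
    Integrable.of_bound ((hk r hr).comp (continuous_id.sub continuous_const)).aestronglyMeasurable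
      r⁻¹ (Eventually.of_forall fun w => hknorm r hr _)
  have hcont : ∀ r, 0 < r → Continuous fun z => ∫ w in E, k r (w - z) := fun r hr => by
    refine continuous_of_dominated (bound := fun _ => r⁻¹) (fun z => (hkE r hr z).1)
      (fun z => Eventually.of_forall fun w => hknorm r hr _) (integrable_const _)
      (Eventually.of_forall fun w => (hk r hr).comp (continuous_const.sub continuous_id))
  set V := volume.real (Metric.ball (0 : ℂ) 1)
  have hbound : ∀ r, 0 < r → ∀ z,
      ‖cauchyTransform E z - ∫ w in E, k r (w - z)‖ ≤ 2 * (V * r) := fun r hr z => by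
    have h1 : Integrable ((Metric.ball (0 : ℂ) r).indicator fun x : ℂ => ‖x‖⁻¹) :=
      (integrableOn_norm_inv_ball r).integrable_indicator measurableSet_ball
    have h2 := h1.comp_sub_right z
    rw [cauchyTransform, ← integral_sub (integrableOn_sub_inv hE z) (hkE r hr z)]
    calc ‖∫ w in E, ((w - z)⁻¹ - k r (w - z))‖
        ≤ ∫ w in E, (Metric.ball (0 : ℂ) r).indicator (fun x : ℂ => ‖x‖⁻¹) (w - z) :=
          norm_integral_le_of_norm_le h2.integrableOn
            (Eventually.of_forall fun w => hkdiff r hr _)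
      _ ≤ ∫ w, (Metric.ball (0 : ℂ) r).indicator (fun x : ℂ => ‖x‖⁻¹) (w - z) :=
          setIntegral_le_integral h2 (Eventually.of_forall fun w =>
            indicator_nonneg (fun _ _ => by positivity) _)
      _ = 2 * (V * r) := by
          rw [integral_sub_right_eq_self
            (fun w => (Metric.ball (0 : ℂ) r).indicator (fun x : ℂ => ‖x‖⁻¹) w) z,
            integral_indicator measurableSet_ball, integral_ball_norm_inv hr.le]
  have hunif : TendstoUniformly (fun (r : ℝ) z => ∫ w in E, k r (w - z)) (cauchyTransform E)
      (𝓝[>] 0) := by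
    rw [Metric.tendstoUniformly_iff]
    intro ε hε
    have h1 : Tendsto (fun r : ℝ => 2 * (V * r)) (𝓝[>] 0) (𝓝 0) := by
      have : Continuous fun r : ℝ => 2 * (V * r) := by fun_prop
      simpa using (this.tendsto 0).mono_left nhdsWithin_le_nhds
    filter_upwards [h1.eventually (gt_mem_nhds hε), self_mem_nhdsWithin] with r hr hr0 z
    rw [dist_eq_norm]
    exact (hbound r hr0 z).trans_lt hr
  refine hunif.continuous (Eventually.frequently ?_)
  filter_upwards [self_mem_nhdsWithin] with r hr
  exact hcont r hr

theorem differentiableOn_cauchyTransform (hE : IsCompact E) :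
    DifferentiableOn ℂ (cauchyTransform E) Eᶜ := by
  intro z hz
  refine DifferentiableAt.differentiableWithinAt ?_
  obtain ⟨δ, hδ, hball⟩ := Metric.isOpen_iff.1 hE.isClosed.isOpen_compl z hz
  have hdist : ∀ w ∈ E, ∀ x ∈ Metric.ball z (δ / 2), δ / 2 ≤ ‖w - x‖ := fun w hw x hx => by
    have h1 : δ ≤ dist w z := by
      by_contra! h
      exact hball h hw
    have h2 := dist_triangle w x z
    rw [Metric.mem_ball] at hx
    rw [← dist_eq_norm]
    linarith
  have : IsFiniteMeasure (volume.restrict E) := ⟨by simpa using hE.measure_lt_top⟩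
  refine (hasDerivAt_integral_of_dominated_loc_of_deriv_le (s := Metric.ball z (δ / 2))
    (F := fun x w => (w - x)⁻¹) (F' := fun x w => ((w - x) ^ 2)⁻¹)
    (bound := fun _ => ((δ / 2) ^ 2)⁻¹)
    (Metric.ball_mem_nhds z (half_pos hδ)) (Eventually.of_forall fun x => ?_)
    (integrableOn_sub_inv hE z) ?_ ?_ (integrable_const _) ?_).2.differentiableAt
  · exact (integrableOn_sub_inv hE x).1
  · exact Measurable.aestronglyMeasurable (by fun_prop)
  · refine ae_restrict_of_forall_mem hE.measurableSet fun w hw x hx => ?_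
    rw [norm_inv, norm_pow]
    have := hdist w hw x hx
    gcongr
  · refine ae_restrict_of_forall_mem hE.measurableSet fun w hw x hx => ?_
    have h1 : w - x ≠ 0 := norm_pos_iff.1 ((half_pos hδ).trans_le (hdist w hw x hx))
    have h2 := ((hasDerivAt_const x w).sub (hasDerivAt_id x)).inv h1
    convert! h2 using 1
    simp [div_eq_mul_inv]

theorem tendsto_mul_cauchyTransform (hE : IsCompact E) :
    Tendsto (fun z => z * cauchyTransform E z) (Bornology.cobounded ℂ)
      (𝓝 (-(volume.real E : ℂ))) := by
  obtain ⟨R, hR0, hR⟩ := hE.isBounded.exists_pos_norm_le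
  have hlim : Tendsto (fun z : ℂ => R * (‖z‖ - R)⁻¹ * volume.real E) (Bornology.cobounded ℂ)
      (𝓝 0) := by
    have h1 : Tendsto (fun z : ℂ => ‖z‖ - R) (Bornology.cobounded ℂ) atTop :=
      tendsto_atTop_add_const_right _ _ tendsto_norm_cobounded_atTop
    simpa using (h1.inv_tendsto_atTop.const_mul R).mul_const (volume.real E)
  rw [tendsto_iff_norm_sub_tendsto_zero]
  refine squeeze_zero' (Eventually.of_forall fun _ => norm_nonneg _) ?_ hlim
  filter_upwards [tendsto_norm_cobounded_atTop.eventually_gt_atTop R] with z hz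
  have hne : ∀ w ∈ E, ‖z‖ - R ≤ ‖w - z‖ := fun w hw => by
    have := norm_sub_norm_le z w
    rw [norm_sub_rev] at this
    linarith [hR w hw]
  have hpos : 0 < ‖z‖ - R := by linarith
  have heq : z * cauchyTransform E z - -(volume.real E : ℂ) = ∫ w in E, w * (w - z)⁻¹ := by
    have h1 : (volume.real E : ℂ) = ∫ w in E, (1 : ℂ) := by simp
    rw [sub_neg_eq_add, h1, cauchyTransform, ← integral_const_mul, ← integral_add
      ((integrableOn_sub_inv hE z).const_mul z) (integrableOn_const hE.measure_lt_top.ne)]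
    refine setIntegral_congr_fun hE.measurableSet fun w hw => ?_
    have h1 : w - z ≠ 0 := norm_pos_iff.1 (hpos.trans_le (hne w hw))
    field_simp
    ring
  rw [heq]
  refine norm_setIntegral_le_of_norm_le_const hE.measure_lt_top fun w hw => ?_
  rw [norm_mul, norm_inv]
  have := hne w hw
  have := hR w hw
  gcongr

theorem tendsto_cauchyTransform (hE : IsCompact E) :
    Tendsto (cauchyTransform E) (Bornology.cobounded ℂ) (𝓝 0) := by
  have h1 := (tendsto_mul_cauchyTransform hE).mul (tendsto_inv₀_cobounded (α := ℂ))
  rw [mul_zero] at h1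
  refine h1.congr' ?_
  filter_upwards [Bornology.eventually_ne_cobounded (0 : ℂ)] with z hz
  field_simp

end CauchyTransform

/-! ### The maximum principle at infinity -/

section MaximumPrinciple

open Filter

/-- The maximum principle on the complement of `E` in the Riemann sphere, for the value at
infinity. -/
theorem norm_limit_cobounded_le {E : Set ℂ} (hE : IsCompact E) (hne : E.Nonempty) {h : ℂ → ℂ}
    (hc : Continuous h) (hd : DifferentiableOn ℂ h Eᶜ) {c : ℂ}
    (hlim : Tendsto h (Bornology.cobounded ℂ) (𝓝 c)) {M : ℝ} (hM : ∀ z ∈ E, ‖h z‖ ≤ M) :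
    ‖c‖ ≤ M := by
  by_contra! hMc
  -- the bounded maximum principle, on large discs
  have hle : ∀ z, ‖h z‖ ≤ ‖c‖ := fun z₀ => by
    refine le_of_forall_gt_imp_ge_of_dense fun C hC => ?_
    by_cases hz₀ : z₀ ∈ E
    · exact (hM z₀ hz₀).trans (hMc.trans hC).le
    have h1 : ∀ᶠ z in Bornology.cobounded ℂ, ‖h z‖ < C := hlim.norm.eventually (gt_mem_nhds hC)
    obtain ⟨R, -, hR⟩ := (hasBasis_cobounded_norm (E := ℂ)).eventually_iff.1 h1
    set R' := max R (‖z₀‖ + 1)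
    have hU : IsOpen (Metric.ball (0 : ℂ) R' \ E) := Metric.isOpen_ball.sdiff hE.isClosed
    refine Complex.norm_le_of_forall_mem_frontier_norm_le (U := Metric.ball (0 : ℂ) R' \ E)
      (Metric.isBounded_ball.subset sdiff_subset) ⟨hd.mono fun z hz => hz.2, hc.continuousOn⟩
      (fun z hz => ?_) (subset_closure ⟨?_, hz₀⟩)
    · rw [hU.frontier_eq] at hz
      by_cases hzE : z ∈ E
      · exact (hM z hzE).trans (hMc.trans hC).le
      · have h2 : z ∉ Metric.ball (0 : ℂ) R' := fun hz' => hz.2 ⟨hz', hzE⟩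
        rw [mem_ball_zero_iff, not_lt] at h2
        exact (hR ((le_max_left _ _).trans h2)).le
    · rw [mem_ball_zero_iff]
      exact (lt_add_one _).trans_le (le_max_right _ _)
  -- in the coordinate `w = z⁻¹`, infinity is an interior maximum
  let u : ℂ → ℂ := Function.update (fun w => h w⁻¹) 0 c
  have hu0 : u 0 = c := by simp [u]
  have hune : ∀ w ≠ 0, u w = h w⁻¹ := fun w hw => by simp [u, hw]
  have hinv : Tendsto (fun w : ℂ => w⁻¹) (𝓝[≠] 0) (Bornology.cobounded ℂ) :=
    tendsto_inv₀_nhdsNE_zero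
  have hucont : ContinuousAt u 0 := continuousAt_update_same.2 (hlim.comp hinv)
  have hudiff : ∀ᶠ w in 𝓝[≠] (0 : ℂ), DifferentiableAt ℂ u w := by
    have h1 : ∀ᶠ z in Bornology.cobounded ℂ, z ∈ Eᶜ := hE.isBounded
    filter_upwards [hinv.eventually h1, self_mem_nhdsWithin] with w hw hw0
    have h2 : DifferentiableAt ℂ (fun w => h w⁻¹) w :=
      (hd.differentiableAt (hE.isClosed.isOpen_compl.mem_nhds hw)).comp w (differentiableAt_inv hw0)
    refine h2.congr_of_eventuallyEq ?_
    filter_upwards [isOpen_ne.mem_nhds hw0] with v hv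
    exact hune v hv
  have hmax : IsLocalMax (norm ∘ u) 0 := Eventually.of_forall fun w => by
    rcases eq_or_ne w 0 with rfl | hw
    · exact le_rfl
    · simpa [hune w hw, hu0] using hle w⁻¹
  have hconst := Complex.norm_eventually_eq_of_isLocalMax
    ((Complex.analyticAt_of_differentiable_on_punctured_nhds_of_continuousAt hudiff
      hucont).eventually_analyticAt.mono fun w hw => hw.differentiableAt) hmax
  obtain ⟨w, hw, hw0⟩ := ((hconst.filter_mono nhdsWithin_le_nhds).and
    (self_mem_nhdsWithin : {(0 : ℂ)}ᶜ ∈ 𝓝[≠] (0 : ℂ))).exists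
  -- so `‖h‖` attains its maximum `‖c‖` on a non-empty clopen set disjoint from `E`
  have hclopen : IsClopen {z | ‖h z‖ = ‖c‖} := by
    refine ⟨isClosed_eq (by fun_prop) continuous_const, isOpen_iff_mem_nhds.2 fun z hz => ?_⟩
    have hzE : z ∉ E := fun hzE => absurd (hM z hzE) (not_le.2 (hz ▸ hMc))
    have h1 : IsLocalMax (norm ∘ h) z := Eventually.of_forall fun y => by
      simpa [show ‖h z‖ = ‖c‖ from hz] using hle y
    have h2 : ∀ᶠ y in 𝓝 z, DifferentiableAt ℂ h y := by
      filter_upwards [hE.isClosed.isOpen_compl.mem_nhds hzE] with y hy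
      exact hd.differentiableAt (hE.isClosed.isOpen_compl.mem_nhds hy)
    filter_upwards [Complex.norm_eventually_eq_of_isLocalMax h2 h1] with y hy
    exact hy.trans hz
  have huniv := hclopen.eq_univ ⟨w⁻¹, by
    rw [hune w hw0, hu0] at hw
    exact hw⟩
  obtain ⟨z, hz⟩ := hne
  have hz' : z ∈ {z | ‖h z‖ = ‖c‖} := huniv ▸ mem_univ z
  exact absurd (hM z hz) (not_le.2 ((show ‖h z‖ = ‖c‖ from hz') ▸ hMc))

end MaximumPrinciple

/-! ### The Cantor set fails the property -/

theorem HasCSWP.of_isEmbedding {K X : Type*} [TopologicalSpace K] [CompactSpace K]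
    [TopologicalSpace X] [CompactSpace X] [T2Space X] (hX : HasCSWP X) {e : K → X}
    (he : IsEmbedding e) : HasCSWP K := by
  have hce : IsClosedEmbedding e := ⟨he, (isCompact_range he.continuous).isClosed⟩
  intro A hA
  let ρ : C(X, ℂ) →ₐ[ℂ] C(K, ℂ) := ContinuousMap.compRightAlgHom ℂ ℂ ⟨e, he.continuous⟩
  have hρ : ∀ f x, ρ f x = f (e x) := fun f x => rfl
  have hρc : Continuous ρ := ContinuousMap.continuous_precomp _
  have hρs : Function.Surjective ρ := fun g => by
    obtain ⟨f, hf⟩ := g.exists_extension hce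
    exact ⟨f, hf⟩
  -- a point off the range of `e` is separated from any other point by an element of the kernel
  have hker : ∀ p q, p ∉ range e → p ≠ q → ∃ f ∈ A.comap ρ, f p ≠ f q := fun p q hp hpq => by
    obtain ⟨u, hu0, hu1, -⟩ := exists_continuous_zero_one_of_isClosed
      (hce.isClosed_range.union (isClosed_singleton (x := q))) (isClosed_singleton (x := p))
      (by simp [hp, hpq])
    refine ⟨⟨fun x => (u x : ℂ), by fun_prop⟩, ?_, ?_⟩
    · have : ρ ⟨fun x => (u x : ℂ), by fun_prop⟩ = 0 := by
        ext x
        have : u (e x) = 0 := hu0 (Or.inl ⟨x, rfl⟩)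
        simp [hρ, this]
      rw [Subalgebra.mem_comap, this]
      exact A.zero_mem
    · have h0 : u q = 0 := hu0 (Or.inr rfl)
      have h1 : u p = 1 := hu1 rfl
      simp [h0, h1]
  have hsep : (A.comap ρ).SeparatesPoints := fun p q hpq => by
    by_cases hp : p ∈ range e
    · by_cases hq : q ∈ range e
      · obtain ⟨x, rfl⟩ := hp
        obtain ⟨y, rfl⟩ := hq
        obtain ⟨_, ⟨g, hg, rfl⟩, hne⟩ := hA (fun h => hpq (congrArg e h))
        obtain ⟨f, rfl⟩ := hρs g
        exact ⟨f, ⟨f, hg, rfl⟩, hne⟩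
      · obtain ⟨f, hf, hne⟩ := hker q p hq hpq.symm
        exact ⟨f, ⟨f, hf, rfl⟩, hne.symm⟩
    · obtain ⟨f, hf, hne⟩ := hker p q hp hpq
      exact ⟨f, ⟨f, hf, rfl⟩, hne⟩
  refine (hρs.denseRange.dense_image hρc (hX _ hsep)).mono ?_
  rintro _ ⟨f, hf, rfl⟩
  exact hf

section PlaneSets

open MeasureTheory Filter

/-- The restrictions to `E` of the functions that are continuous on the Riemann sphere and
holomorphic in the plane off `E`. -/
def sphereAlgebra (E : Set ℂ) : Subalgebra ℂ C(E, ℂ) where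
  carrier := {g | ∃ h : ℂ → ℂ, Continuous h ∧ DifferentiableOn ℂ h Eᶜ ∧
    (∃ c, Tendsto h (Bornology.cobounded ℂ) (𝓝 c)) ∧ ∀ z : E, g z = h z}
  mul_mem' := by
    rintro g k ⟨h, hc, hd, ⟨c, hl⟩, hg⟩ ⟨h', hc', hd', ⟨c', hl'⟩, hk⟩
    exact ⟨fun z => h z * h' z, hc.mul hc', hd.mul hd', ⟨_, hl.mul hl'⟩, fun z => by simp [hg, hk]⟩
  add_mem' := by
    rintro g k ⟨h, hc, hd, ⟨c, hl⟩, hg⟩ ⟨h', hc', hd', ⟨c', hl'⟩, hk⟩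
    exact ⟨fun z => h z + h' z, hc.add hc', hd.add hd', ⟨_, hl.add hl'⟩, fun z => by simp [hg, hk]⟩
  algebraMap_mem' c := ⟨fun _ => c, continuous_const, differentiableOn_const c,
    ⟨c, tendsto_const_nhds⟩, fun _ => rfl⟩

/-- With the Cauchy transform `f` of `E`, this algebra also contains the difference quotients
`(f z - f z₀) / (z - z₀)` for `z₀` off `E`; they separate the points at which `f` agrees. -/
theorem separatesPoints_sphereAlgebra {E : Set ℂ} (hE : IsCompact E) (hpos : 0 < volume.real E) :
    (sphereAlgebra E).SeparatesPoints := by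
  intro x y hxy
  have hne : (x : ℂ) ≠ y := fun h => hxy (Subtype.ext h)
  set f := cauchyTransform E
  have hf := continuous_cauchyTransform hE
  have hfd := differentiableOn_cauchyTransform hE
  by_cases hfxy : f x = f y
  swap
  · exact ⟨_, ⟨⟨fun z : E => f z, by fun_prop⟩,
      ⟨f, hf, hfd, ⟨0, tendsto_cauchyTransform hE⟩, fun _ => rfl⟩, rfl⟩, hfxy⟩
  obtain ⟨z₀, hz₀, hfz₀⟩ : ∃ z₀ ∉ E, f z₀ ≠ f x := by
    by_contra! hconst
    have hev : ∀ᶠ z in Bornology.cobounded ℂ, z ∉ E := hE.isBounded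
    have h1 : f x = 0 := tendsto_nhds_unique
      (tendsto_const_nhds.congr' (hev.mono fun z hz => (hconst z hz).symm))
      (tendsto_cauchyTransform hE)
    have h2 := tendsto_nhds_unique (tendsto_mul_cauchyTransform hE)
      (tendsto_const_nhds.congr' (hev.mono fun z hz => by
        change 0 = z * f z
        rw [hconst z hz, h1, mul_zero]))
    rw [neg_eq_zero, Complex.ofReal_eq_zero] at h2
    exact hpos.ne' h2
  have hEc : Eᶜ ∈ 𝓝 z₀ := hE.isClosed.isOpen_compl.mem_nhds hz₀
  have hg : Continuous (dslope f z₀) := by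
    rw [← continuousOn_univ, continuousOn_dslope univ_mem]
    exact ⟨hf.continuousOn, hfd.differentiableAt hEc⟩
  have hval : ∀ z ≠ z₀, dslope f z₀ z = (f z - f z₀) * (z - z₀)⁻¹ := fun z hz => by
    rw [dslope_of_ne _ hz, slope_def_field, div_eq_mul_inv]
  have hlim : Tendsto (dslope f z₀) (Bornology.cobounded ℂ) (𝓝 ((0 - f z₀) * 0)) := by
    have h1 : Tendsto (fun z => (z - z₀)⁻¹) (Bornology.cobounded ℂ) (𝓝 0) :=
      tendsto_inv₀_cobounded.comp (tendsto_sub_const_cobounded z₀)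
    refine (((tendsto_cauchyTransform hE).sub_const (f z₀)).mul h1).congr' ?_
    filter_upwards [Bornology.eventually_ne_cobounded z₀] with z hz
    exact (hval z hz).symm
  refine ⟨_, ⟨⟨fun z : E => dslope f z₀ z, by fun_prop⟩, ⟨dslope f z₀, hg,
    (Complex.differentiableOn_dslope hEc).2 hfd, ⟨_, hlim⟩, fun _ => rfl⟩, rfl⟩, ?_⟩
  have hx : (x : ℂ) ≠ z₀ := fun h => hz₀ (h ▸ x.2)
  have hy : (y : ℂ) ≠ z₀ := fun h => hz₀ (h ▸ y.2)
  change dslope f z₀ x ≠ dslope f z₀ y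
  rw [hval _ hx, hval _ hy, ← hfxy]
  intro h
  have h1 := inv_injective (mul_left_cancel₀ (sub_ne_zero.2 hfz₀.symm) h)
  exact hne (sub_left_injective h1)

/-- If `a` in the algebra approximates the identity on `E`, then `a * f - z * f`, with the Cauchy
transform `f` of `E`, is small on `E`, but its value at infinity is the area of `E`. -/
theorem not_hasCSWP_of_area_pos {E : Set ℂ} (hE : IsCompact E) (hpos : 0 < volume.real E) :
    ¬ HasCSWP E := by
  intro hcswp
  have : CompactSpace E := isCompact_iff_compactSpace.1 hE
  have hne : E.Nonempty := by
    by_contra h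
    rw [not_nonempty_iff_eq_empty] at h
    simp [h] at hpos
  have hdense := hcswp _ (separatesPoints_sphereAlgebra hE hpos)
  set f := cauchyTransform E
  have hf : Continuous f := continuous_cauchyTransform hE
  have hfd : DifferentiableOn ℂ f Eᶜ := differentiableOn_cauchyTransform hE
  set m := volume.real E
  obtain ⟨N, hN0, hN⟩ := (hE.image hf).isBounded.exists_pos_norm_le
  let ι : C(E, ℂ) := ⟨Subtype.val, continuous_subtype_val⟩
  obtain ⟨a, hdist, h, hc, hd, ⟨c, hl⟩, ha⟩ :=
    Metric.dense_iff.1 hdense ι (m / (2 * N)) (by positivity)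
  rw [Metric.mem_ball, dist_eq_norm] at hdist
  have hlim : Tendsto (fun z => h z * f z - z * f z) (Bornology.cobounded ℂ)
      (𝓝 (c * 0 - -(m : ℂ))) :=
    (hl.mul (tendsto_cauchyTransform hE)).sub (tendsto_mul_cauchyTransform hE)
  have hM : ∀ z ∈ E, ‖h z * f z - z * f z‖ ≤ m / (2 * N) * N := fun z hz => by
    have h1 : ‖a ⟨z, hz⟩ - z‖ ≤ m / (2 * N) := ((a - ι).norm_coe_le_norm ⟨z, hz⟩).trans hdist.le
    rw [ha] at h1
    rw [← sub_mul, norm_mul]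
    exact mul_le_mul h1 (hN (f z) (mem_image_of_mem f hz)) (norm_nonneg _) (by positivity)
  have hle := norm_limit_cobounded_le (h := fun z => h z * f z - z * f z) hE hne
    ((hc.mul hf).sub (continuous_id.mul hf)) ((hd.mul hfd).sub (differentiableOn_id.mul hfd)) hlim
    hM
  rw [mul_zero, zero_sub, neg_neg, Complex.norm_real, Real.norm_of_nonneg hpos.le] at hle
  have h3 : m / (2 * N) * N = m / 2 := by field_simp
  rw [h3] at hle
  linarith

theorem volume_re_mem_or_im_mem_eq_zero {s : Set ℝ} (hs : s.Countable) :
    volume {z : ℂ | z.re ∈ s ∨ z.im ∈ s} = 0 := by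
  have h1 : volume ((s ×ˢ univ ∪ univ ×ˢ s : Set (ℝ × ℝ))) = 0 := by
    rw [measure_union_null_iff, Measure.volume_eq_prod, Measure.prod_prod, Measure.prod_prod]
    simp [hs.measure_zero]
  have h2 := Complex.volume_preserving_equiv_real_prod.measure_preimage
    (NullMeasurableSet.of_null h1)
  rw [h1] at h2
  convert h2 using 2
  ext z
  simp

/-- There is a compact plane set of positive area all of whose points have irrational
coordinates. -/
theorem exists_isCompact_irrational_area_pos : ∃ E : Set ℂ, IsCompact E ∧ 0 < volume.real E ∧
    ∀ z ∈ E, z.re ∉ range ((↑) : ℚ → ℝ) ∧ z.im ∉ range ((↑) : ℚ → ℝ) := by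
  have hnull := volume_re_mem_or_im_mem_eq_zero (countable_range ((↑) : ℚ → ℝ))
  have hball : 0 < volume (Metric.closedBall (0 : ℂ) 1) :=
    Metric.measure_closedBall_pos _ _ one_pos
  obtain ⟨U, hU, hUo, hUv⟩ := Set.exists_isOpen_lt_of_lt _ _ (hnull.trans_lt hball)
  have hE : IsCompact (Metric.closedBall (0 : ℂ) 1 \ U) := (isCompact_closedBall 0 1).diff hUo
  refine ⟨_, hE, ENNReal.toReal_pos ?_ hE.measure_lt_top.ne, fun z hz => ?_⟩
  · exact ((tsub_pos_of_lt hUv).trans_le le_measure_sdiff).ne'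
  · exact ⟨fun h => hz.2 (hU (Or.inl h)), fun h => hz.2 (hU (Or.inr h))⟩

/-- The rational cuts of the two coordinates embed such a set into the Cantor set. -/
theorem exists_isEmbedding_cantorSet_of_irrational {E : Set ℂ} (hE : IsCompact E)
    (hirr : ∀ z ∈ E, z.re ∉ range ((↑) : ℚ → ℝ) ∧ z.im ∉ range ((↑) : ℚ → ℝ)) :
    ∃ e : E → cantorSet, IsEmbedding e := by
  have : CompactSpace E := isCompact_iff_compactSpace.1 hE
  let c : ℚ ⊕ ℚ → E → Bool := Sum.elim (fun q z => decide ((q : ℝ) < z.1.re))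
    fun q z => decide ((q : ℝ) < z.1.im)
  have hcut : ∀ φ : E → ℝ, Continuous φ → (∀ z, φ z ∉ range ((↑) : ℚ → ℝ)) → ∀ q : ℚ,
      Continuous fun z => decide ((q : ℝ) < φ z) := fun φ hφ hφq q => by
    rw [continuous_bool_rng true]
    have h1 : (fun z => decide ((q : ℝ) < φ z)) ⁻¹' {true} = {z | (q : ℝ) < φ z} := by
      ext z
      simp
    rw [h1]
    refine ⟨?_, isOpen_lt continuous_const hφ⟩
    have h2 : {z | (q : ℝ) < φ z} = {z | (q : ℝ) ≤ φ z} := by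
      ext z
      have : (q : ℝ) ≠ φ z := fun h => hφq z ⟨q, h⟩
      simp only [mem_ofPred_eq, le_iff_lt_or_eq, this, or_false]
    rw [h2]
    exact isClosed_le continuous_const hφ
  have hc : ∀ i, Continuous (c i) := by
    rintro (q | q)
    · exact hcut (fun z => z.1.re) (by fun_prop) (fun z => (hirr z z.2).1) q
    · exact hcut (fun z => z.1.im) (by fun_prop) (fun z => (hirr z z.2).2) q
  let e : E → ℕ → Bool := fun z n => c ((Denumerable.eqv (ℚ ⊕ ℚ)).symm n) z
  have he : Continuous e := continuous_pi fun n => hc _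
  have hreal : ∀ s t : ℝ, (∀ q : ℚ, decide ((q : ℝ) < s) = decide ((q : ℝ) < t)) → s = t :=
    fun s t hst => by
      refine le_antisymm (le_of_forall_rat_lt_imp_le fun q hq => ?_)
        (le_of_forall_rat_lt_imp_le fun q hq => ?_)
      · exact (by simpa [hq] using hst q : (q : ℝ) < t).le
      · exact (by simpa [hq] using hst q : (q : ℝ) < s).le
  have hinj : Function.Injective e := fun z w hzw => by
    have h1 : ∀ i, c i z = c i w := fun i => by
      have := congrFun hzw (Denumerable.eqv (ℚ ⊕ ℚ) i)
      simpa [e] using this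
    exact Subtype.ext (Complex.ext (hreal _ _ fun q => h1 (Sum.inl q))
      (hreal _ _ fun q => h1 (Sum.inr q)))
  exact ⟨_, cantorSetHomeomorphNatToBool.symm.isEmbedding.comp
    (he.isClosedEmbedding hinj).isEmbedding⟩

end PlaneSets

theorem not_hasCSWP_of_containsCantorSet {X : Type*} [TopologicalSpace X] [CompactSpace X]
    [T2Space X] (hX : ContainsCantorSet X) : ¬ HasCSWP X := by
  obtain ⟨f, hf⟩ := hX
  obtain ⟨E, hE, hpos, hirr⟩ := exists_isCompact_irrational_area_pos
  obtain ⟨e, he⟩ := exists_isEmbedding_cantorSet_of_irrational hE hirr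
  have : CompactSpace E := isCompact_iff_compactSpace.1 hE
  exact fun h => not_hasCSWP_of_area_pos hE hpos (h.of_isEmbedding (hf.comp he))

/-! ### The double arrow space -/

theorem compactSpace_of_forall_exists_isLUB {α : Type*} [LinearOrder α] [TopologicalSpace α]
    [OrderTopology α] (h : ∀ s : Set α, ∃ a, IsLUB s a) : CompactSpace α := by
  choose sup hsup using h
  let _ : SupSet α := ⟨sup⟩
  have hbot : ∀ x, sup ∅ ≤ x := fun x => (hsup ∅).2 (by simp)
  have htop : ∀ x, x ≤ sup univ := fun x => (hsup univ).1 (mem_univ x)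
  let _ : ConditionallyCompleteLinearOrder α :=
    { conditionallyCompleteLatticeOfLatticeOfsSup α (fun s _ _ => hsup s), ‹LinearOrder α› with
      csSup_of_not_bddAbove := fun s hs => absurd ⟨sup univ, fun x _ => htop x⟩ hs
      csInf_of_not_bddBelow := fun s hs => absurd ⟨sup ∅, fun x _ => hbot x⟩ hs }
  refine ⟨?_⟩
  have h1 : (univ : Set α) = Icc (sup ∅) (sup univ) := by
    ext x
    simp [hbot, htop]
  rw [h1]
  exact isCompact_Icc

namespace DoubledInterval

variable {E : Set ℝ}

/-- The point of the unit interval that lies under a point of the doubled interval. -/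
def proj (p : DoubledInterval E) : ℝ := (ofLex p.1).1

/-- The level, `0` or `1`, of a point of the doubled interval. -/
def level (p : DoubledInterval E) : Fin 2 := (ofLex p.1).2

/-- The lower copy of a point of the unit interval. -/
def lower {t : ℝ} (ht : t ∈ Icc (0 : ℝ) 1) : DoubledInterval E := ⟨toLex (t, 0), Or.inl ⟨ht, rfl⟩⟩

/-- The upper copy of a point of `E`. -/
def upper {t : ℝ} (ht : t ∈ E) : DoubledInterval E := ⟨toLex (t, 1), Or.inr ⟨ht, rfl⟩⟩

@[simp]
theorem proj_lower {t : ℝ} (ht : t ∈ Icc (0 : ℝ) 1) : proj (lower ht : DoubledInterval E) = t := rfl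

@[simp]
theorem level_lower {t : ℝ} (ht : t ∈ Icc (0 : ℝ) 1) : level (lower ht : DoubledInterval E) = 0 :=
  rfl

@[simp]
theorem proj_upper {t : ℝ} (ht : t ∈ E) : proj (upper ht) = t := rfl

@[simp]
theorem level_upper {t : ℝ} (ht : t ∈ E) : level (upper ht) = 1 := rfl

theorem le_iff {p q : DoubledInterval E} :
    p ≤ q ↔ proj p < proj q ∨ proj p = proj q ∧ level p ≤ level q :=
  Prod.Lex.le_iff

theorem lt_iff {p q : DoubledInterval E} :
    p < q ↔ proj p < proj q ∨ proj p = proj q ∧ level p < level q :=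
  Prod.Lex.lt_iff

theorem proj_mono {p q : DoubledInterval E} (h : p ≤ q) : proj p ≤ proj q := by
  rcases le_iff.1 h with h | h
  · exact h.le
  · exact h.1.le

theorem mem_of_level_ne_zero {p : DoubledInterval E} (h : level p ≠ 0) : proj p ∈ E := by
  rcases p.2 with h' | h'
  · exact absurd h'.2 h
  · exact h'.1

theorem eq_lower_of_level_eq_zero {p : DoubledInterval E} (h : level p = 0)
    (hp : proj p ∈ Icc (0 : ℝ) 1) : p = lower hp :=
  Subtype.ext (congrArg toLex (Prod.ext rfl h))

theorem eq_upper_of_level_ne_zero {p : DoubledInterval E} (h : level p ≠ 0)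
    (hp : proj p ∈ E) : p = upper hp :=
  Subtype.ext (congrArg toLex (Prod.ext rfl (Fin.eq_one_of_ne_zero _ h)))

theorem proj_mem_Icc (hE : E ⊆ Icc 0 1) (p : DoubledInterval E) : proj p ∈ Icc (0 : ℝ) 1 := by
  rcases p.2 with h | h
  · exact h.1
  · exact hE h.1

theorem lower_covBy_upper {t : ℝ} (ht : t ∈ E) (ht' : t ∈ Icc (0 : ℝ) 1) :
    (lower ht' : DoubledInterval E) ⋖ upper ht := by
  refine ⟨lt_iff.2 (Or.inr ⟨rfl, by simp⟩), fun c h1 h2 => ?_⟩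
  have hc : proj c = t := le_antisymm (proj_mono h2.le) (proj_mono h1.le)
  rw [lt_iff] at h1 h2
  simp only [proj_lower, proj_upper, hc, lt_irrefl, true_and, false_or, level_lower,
    level_upper] at h1 h2
  omega

/-- The supremum of a set without greatest element is the lower copy of the supremum of its
projection. -/
theorem compactSpace (hE : E ⊆ Icc 0 1) : CompactSpace (DoubledInterval E) := by
  refine compactSpace_of_forall_exists_isLUB fun S => ?_
  rcases S.eq_empty_or_nonempty with rfl | hne
  · refine ⟨lower (left_mem_Icc.2 zero_le_one), by simp, fun b _ => le_iff.2 ?_⟩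
    rcases (proj_mem_Icc hE b).1.lt_or_eq with h | h
    · exact Or.inl h
    · exact Or.inr ⟨h, Fin.zero_le _⟩
  by_cases hmax : ∃ p ∈ S, p ∈ upperBounds S
  · obtain ⟨p, hp, hub⟩ := hmax
    exact ⟨p, IsGreatest.isLUB ⟨hp, hub⟩⟩
  push Not at hmax
  have hbdd : BddAbove (proj '' S) := ⟨1, by
    rintro _ ⟨p, -, rfl⟩
    exact (proj_mem_Icc hE p).2⟩
  have hle : ∀ p ∈ S, proj p ≤ sSup (proj '' S) := fun p hp => le_csSup hbdd ⟨p, hp, rfl⟩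
  have ht : sSup (proj '' S) ∈ Icc (0 : ℝ) 1 := by
    obtain ⟨p, hp⟩ := hne
    refine ⟨(proj_mem_Icc hE p).1.trans (hle p hp), csSup_le ⟨_, p, hp, rfl⟩ ?_⟩
    rintro _ ⟨q, -, rfl⟩
    exact (proj_mem_Icc hE q).2
  refine ⟨lower ht, fun p hp => le_iff.2 ?_, fun b hb => le_iff.2 ?_⟩
  · rcases (hle p hp).lt_or_eq with h | h
    · exact Or.inl h
    refine Or.inr ⟨h, ?_⟩
    by_contra hlev
    refine hmax p hp fun q hq => le_iff.2 ?_
    rcases (hle q hq).lt_or_eq with h' | h'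
    · exact Or.inl (h'.trans_eq h.symm)
    · refine Or.inr ⟨h'.trans h.symm, ?_⟩
      rw [level_lower] at hlev
      omega
  · have h1 : sSup (proj '' S) ≤ proj b := by
      refine csSup_le (hne.image _) ?_
      rintro _ ⟨p, hp, rfl⟩
      exact proj_mono (hb hp)
    rcases h1.lt_or_eq with h | h
    · exact Or.inl h
    · exact Or.inr ⟨h, Fin.zero_le _⟩

theorem perfect_univ (hE : E ⊆ Ioo 0 1) : Perfect (univ : Set (DoubledInterval E)) := by
  have hE' : E ⊆ Icc 0 1 := hE.trans Ioo_subset_Icc_self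
  have hmid : ∀ p q : DoubledInterval E, proj p < proj q → ∃ r : DoubledInterval E,
      p < r ∧ r < q := fun p q hpq => by
    have h1 := (proj_mem_Icc hE' p).1
    have h2 := (proj_mem_Icc hE' q).2
    have ht : (proj p + proj q) / 2 ∈ Icc (0 : ℝ) 1 := ⟨by linarith, by linarith⟩
    have hpt : proj p < (proj p + proj q) / 2 := by linarith
    have htq : (proj p + proj q) / 2 < proj q := by linarith
    exact ⟨lower ht, lt_iff.2 (Or.inl hpt), lt_iff.2 (Or.inl htq)⟩
  refine ⟨isClosed_univ, fun x _ => ?_⟩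
  rw [accPt_principal_iff_clusterPt, ← mem_closure_iff_clusterPt]
  have hx := proj_mem_Icc hE' x
  by_cases hx0 : level x = 0 ∧ 0 < proj x
  · have hlub : IsLUB (Iio x) x := by
      refine ⟨fun y hy => le_of_lt hy, fun b hb => not_lt.1 fun hbx => ?_⟩
      have h1 : proj b < proj x := by
        rcases lt_iff.1 hbx with h | h
        · exact h
        · have := h.2
          rw [hx0.1] at this
          exact absurd this (Fin.not_lt_zero _)
      obtain ⟨r, hr1, hr2⟩ := hmid b x h1
      exact absurd (hb hr2) (not_le.2 hr1)
    refine closure_mono (s := Iio x) (t := univ \ {x}) (fun y hy => ⟨mem_univ y, ne_of_lt hy⟩)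
      (hlub.mem_closure ?_)
    exact ⟨lower (left_mem_Icc.2 zero_le_one), lt_iff.2 (Or.inl hx0.2)⟩
  · -- no point above `x` has the same projection
    have hproj : proj x < 1 ∧ ∀ b, x < b → proj x < proj b := by
      by_cases hlev : level x = 0
      · have hx' : proj x = 0 := le_antisymm (not_lt.1 fun h => hx0 ⟨hlev, h⟩) hx.1
        refine ⟨by rw [hx']; exact one_pos, fun b hb => ?_⟩
        rcases lt_iff.1 hb with h | ⟨h, h'⟩
        · exact h
        · have hbE := hE (mem_of_level_ne_zero (p := b) (fun h0 => by
            rw [h0] at h'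
            exact absurd h' (Fin.not_lt_zero _)))
          rw [hx']
          exact hbE.1
      · refine ⟨(hE (mem_of_level_ne_zero hlev)).2, fun b hb => ?_⟩
        rcases lt_iff.1 hb with h | ⟨h, h'⟩
        · exact h
        · omega
    have hglb : IsGLB (Ioi x) x := by
      refine ⟨fun y hy => le_of_lt hy, fun b hb => not_lt.1 fun hxb => ?_⟩
      obtain ⟨r, hr1, hr2⟩ := hmid x b (hproj.2 b hxb)
      exact absurd (hb hr1) (not_le.2 hr2)
    refine closure_mono (s := Ioi x) (t := univ \ {x}) (fun y hy => ⟨mem_univ y, ne_of_gt hy⟩)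
      (hglb.mem_closure ?_)
    exact ⟨lower (right_mem_Icc.2 zero_le_one), lt_iff.2 (Or.inl hproj.1)⟩

theorem not_countable_nat_bool : ¬ Countable (ℕ → Bool) := fun h => by
  obtain ⟨f, hf⟩ := exists_injective_nat (ℕ → Bool)
  refine Function.cantor_injective (fun s : Set ℕ => f fun n => ?_) ?_
  · classical exact decide (n ∈ s)
  · intro s t hst
    ext n
    simpa using congrFun (hf hst) n

/-- The clopen sets `{x | x ≤ (t, 0)}` trace uncountably many clopen sets on a subspace with
uncountably many points, whereas the Cantor set has only countably many clopen sets. -/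
theorem not_containsCantorSet : ¬ ContainsCantorSet DoubleArrow := by
  rintro ⟨g₀, hg₀⟩
  obtain ⟨g, hg⟩ : ∃ g : (ℕ → Bool) → DoubleArrow, IsEmbedding g :=
    ⟨_, hg₀.comp cantorSetHomeomorphNatToBool.symm.isEmbedding⟩
  refine not_countable_nat_bool ?_
  have hsub : Ioo (0 : ℝ) 1 ⊆ Icc 0 1 := Ioo_subset_Icc_self
  have hclopens : Countable (TopologicalSpace.Clopens (ℕ → Bool)) :=
    TopologicalSpace.Clopens.countable_iff_secondCountable.2 inferInstance
  let S : Set (ℕ → Bool) := {c | proj (g c) ∈ Ioo (0 : ℝ) 1}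
  let cut : S → TopologicalSpace.Clopens (ℕ → Bool) := fun c =>
    ⟨g ⁻¹' Iic (lower (hsub c.2)),
      (isClopen_Iic_of_covBy (lower_covBy_upper c.2 (hsub c.2))).preimage hg.continuous⟩
  have hmem : ∀ (x : ℕ → Bool) (c : S), x ∈ cut c ↔ g x ≤ lower (hsub c.2) := fun x c => Iff.rfl
  have hinj : Function.Injective fun c : S => (cut c, level (g c)) := by
    intro c d hcd
    simp only [Prod.mk.injEq] at hcd
    obtain ⟨hcut, hlev⟩ := hcd
    refine Subtype.ext (hg.injective ?_)
    by_cases h0 : level (g c) = 0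
    · have hc := eq_lower_of_level_eq_zero h0 (hsub c.2)
      have hd := eq_lower_of_level_eq_zero (hlev ▸ h0) (hsub d.2)
      have h1 : (c : ℕ → Bool) ∈ cut d := hcut ▸ (hmem _ _).2 hc.le
      have h2 : (d : ℕ → Bool) ∈ cut c := hcut ▸ (hmem _ _).2 hd.le
      exact le_antisymm (((hmem _ _).1 h1).trans hd.ge) (((hmem _ _).1 h2).trans hc.ge)
    · have hlt : ∀ e : S, level (g e) ≠ 0 → lower (hsub e.2) ⋖ g e := fun e he => by
        have h1 := lower_covBy_upper (show proj (g e) ∈ Ioo (0 : ℝ) 1 from e.2) (hsub e.2)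
        rwa [← eq_upper_of_level_ne_zero he e.2] at h1
      have hc := hlt c h0
      have hd := hlt d (hlev ▸ h0)
      have h1 : (c : ℕ → Bool) ∉ cut d := hcut ▸ fun h => not_le.2 hc.lt ((hmem _ _).1 h)
      have h2 : (d : ℕ → Bool) ∉ cut c := hcut ▸ fun h => not_le.2 hd.lt ((hmem _ _).1 h)
      exact le_antisymm (hc.ge_of_gt (not_le.1 fun h => h2 ((hmem _ _).2 h)))
        (hd.ge_of_gt (not_le.1 fun h => h1 ((hmem _ _).2 h)))
  have hS : S.Countable := hinj.countable.to_set
  have hSc : Sᶜ.Countable := by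
    have hfin : (g ⁻¹' {lower (left_mem_Icc.2 zero_le_one),
        lower (right_mem_Icc.2 zero_le_one)}).Finite :=
      (toFinite _).preimage hg.injective.injOn
    refine hfin.countable.mono fun c hc => ?_
    have hlev : level (g c) = 0 := by
      by_contra h
      exact hc (mem_of_level_ne_zero h)
    have hIcc := proj_mem_Icc hsub (g c)
    have hends : proj (g c) = 0 ∨ proj (g c) = 1 := by
      by_contra! h
      exact hc ⟨lt_of_le_of_ne hIcc.1 h.1.symm, lt_of_le_of_ne hIcc.2 h.2⟩
    have heq := eq_lower_of_level_eq_zero hlev hIcc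
    rcases hends with h | h
    · left
      rw [heq]
      congr
    · right
      rw [mem_singleton_iff, heq]
      congr
  rw [← countable_univ_iff, ← union_compl_self S]
  exact hS.union hSc

end DoubledInterval

theorem theorem1p5 :
    (∀ (X : Type*) [LinearOrder X] [TopologicalSpace X] [OrderTopology X] [CompactSpace X],
      HasCSWP X ↔ ¬ ContainsCantorSet X) ∧
    (CompactSpace DoubleArrow ∧ ¬ IsScatteredSpace DoubleArrow ∧
      ¬ ContainsCantorSet DoubleArrow ∧ HasCSWP DoubleArrow) := by
  have hcompact : CompactSpace DoubleArrow := DoubledInterval.compactSpace Ioo_subset_Icc_self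
  refine ⟨fun X _ _ _ _ => ⟨fun h hX => not_hasCSWP_of_containsCantorSet hX h,
    hasCSWP_of_not_containsCantorSet⟩, hcompact, ?_, DoubledInterval.not_containsCantorSet,
    hasCSWP_of_not_containsCantorSet DoubledInterval.not_containsCantorSet⟩
  exact not_not.2 ⟨univ, ⟨DoubledInterval.lower (left_mem_Icc.2 zero_le_one), mem_univ _⟩,
    DoubledInterval.perfect_univ Subset.rfl⟩
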